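/- Let $\mathbb K$ be an algebraically closed field of characteristic $0$ and let $q,N\ge 2$ be integers. An $N$-homogeneous algebra generated by $q$ elements $x^1,\dots,x^q$ is an algebra $\mathcal A=A(E,R)=T(E)/(R)$, where $E=\bigoplus_{\lambda}\mathbb K x^\lambda$ and $R\subset E^{\otimes N}$ is a linear subspace (its space of relations), graded by $\deg x^\lambda=1$. Put $J_n=E^{\otimes n}$ for $n<N$ and $J_n=\bigcap_{r+N+s=n}E^{\otimes r}\otimes R\otimes E^{\otimes s}$ for $n\ge N$, and let $d:\mathcal A\otimes J_{n+1}\to\mathcal A\otimes J_n$ be induced by $a\otimes(v_0\otimes v_1\otimes\dots\otimes v_n)\mapsto av_0\otimes(v_1\otimes\dots\otimes v_n)$. The algebra $\mathcal A$ is Koszul if the complex $$\cdots\xrightarrow{d^{N-1}}\mathcal A\otimes J_{N+1}\xrightarrow{d}\mathcal A\otimes J_N\xrightarrow{d^{N-1}}\mathcal A\otimes J_1\xrightarrow{d}\mathcal A\otimes J_0\to 0,$$ whose terms are the $\mathcal A\otimes J_{kN}$ and $\mathcal A\otimes J_{kN+1}$, $k\ge 0$, is acyclic in positive degrees. For $\mathcal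 A$ of global dimension $D$, Gorenstein means that $\mathrm{Ext}^i_{\mathcal A}(\mathbb K,\mathcal A)=0$ for $i\ne D$ and $\mathrm{Ext}^D_{\mathcal A}(\mathbb K,\mathcal A)\cong\mathbb K$, where $\mathbb K$ is the trivial left $\mathcal A$-module. An $(N+1)$-linear form $W$ on a vector space $V$ is 3-regular if: (i) if $X\in V$ satisfies $W(X,X_1,\dots,X_N)=0$ for all $X_1,\dots,X_N\in V$, then $X=0$; (ii) there is $Q_W\in GL(V)$ such that $W(X_0,\dots,X_{N-1},X_N)=W(Q_WX_N,X_0,\dots,X_{N-1})$ for all $X_0,\dots,X_N\in V$; (iii) if $L_0,L_1\in\mathrm{End}(V)$ satisfy $W(L_0X_0,X_1,X_2,\dots,X_N)=W(X_0,L_1X_1,X_2,\dots,X_N)$ for all $X_0,\dots,X_N\in V$, then $L_0=L_1=c\,\mathbb 1$ for some $c\in\mathbb K$. For an $(N+1)$-linear form $W$ on $\mathbb K^q$ with components $W_{\lambda_0\dots\lambda_N}=W(e_{\lambda_0},\dots,e_{\lambda_N})$ in the canonical basis, let $R_W\subset E^{\otimes N}$ be the span of the elements $\sum_{\lambda_1,\dots,\lambda_N}W_{\lambda\lambda_1\dots\lambda_N}\,x^{\lambda_1}\otimes\dots\otimes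 x^{\lambda_N}$, $\lambda\in\{1,\dots,q\}$. **Theorem.** (a) Let $\mathcal A=A(E,R)$ be an $N$-homogeneous algebra generated by $q$ elements $x^\lambda$ which is Koszul of global dimension $3$ and Gorenstein. Then there is a 3-regular $(N+1)$-linear form $W$ on $\mathbb K^q$ such that the relations of $\mathcal A$ read $\sum_{\lambda_1,\dots,\lambda_N}W_{\lambda\lambda_1\dots\lambda_N}x^{\lambda_1}\cdots x^{\lambda_N}=0$ for $\lambda\in\{1,\dots,q\}$, that is, $R=R_W$. (b) If $W$ and $W'$ are 3-regular $(N+1)$-linear forms on $\mathbb K^q$ in the same $GL(q,\mathbb K)$-orbit, i.e. $W'(X_0,\dots,X_N)=W(L^{-1}X_0,\dots,L^{-1}X_N)$ for some $L\in GL(q,\mathbb K)$, then $A(E,R_W)$ and $A(E,R_{W'})$ are isomorphic as graded algebras. -/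

import Mathlib

open scoped TensorProduct

noncomputable section

universe u v

namespace HomogeneousAlgebra

/-! ### Multilinear forms -/

section Forms

variable {K : Type u} [Field K] {V : Type v} [AddCommGroup V] [Module K V]

/-- An `(n+1)`-linear form on `V`, with slots numbered `0, …, n`. -/
abbrev Form (K : Type u) [Field K] (V : Type v) [AddCommGroup V] [Module K V] (n : ℕ) :
    Type (max u v) :=
  MultilinearMap K (fun _ : Fin (n + 1) => V) K

/-- Preregularity: (i) `W` is nondegenerate in its first argument; (ii) `W` is cyclic up to a twist
`Q ∈ GL(V)`, that is `W(X₀, …, Xₙ₋₁, Xₙ) = W(Q Xₙ, X₀, …, Xₙ₋₁)`. -/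
structure IsPreregular {n : ℕ} (W : Form K V n) : Prop where
  nondegenerate : ∀ X : V, (∀ Y : Fin n → V, W (Fin.cons X Y) = 0) → X = 0
  twisted_cyclic : ∃ Q : V ≃ₗ[K] V, ∀ (X : Fin n → V) (Z : V),
    W (Fin.snoc X Z) = W (Fin.cons (Q Z) X)

/-- A preregular form `W` is 3-regular if the identity
`W(L₀ X₀, X₁, X₂, …, X_N) = W(X₀, L₁ X₁, X₂, …, X_N)` (for all `Xᵢ`) between endomorphisms
`L₀, L₁` of `V` only holds when `L₀ = L₁` is a scalar. (Used for `N ≥ 2`.) -/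
structure IsThreeRegular {N : ℕ} (W : Form K V N) : Prop extends IsPreregular W where
  rigid : ∀ L₀ L₁ : Module.End K V,
    (∀ X : Fin (N + 1) → V,
      W (Function.update X 0 (L₀ (X 0))) = W (Function.update X 1 (L₁ (X 1)))) →
    ∃ c : K, L₀ = c • LinearMap.id ∧ L₁ = c • LinearMap.id

/-- The action of `GL(V)` on forms: `(W^L)(X₀, …, Xₙ) = W(L⁻¹ X₀, …, L⁻¹ Xₙ)`. -/
def Form.act {n : ℕ} (L : V ≃ₗ[K] V) (W : Form K V n) : Form K V n :=
  W.compLinearMap fun _ => (L.symm : V →ₗ[K] V)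

end Forms

/-! ### Homogeneous algebras on `q` generators -/

section Algebras

variable (K : Type u) [Field K] (q : ℕ)

/-- The tensor algebra `T(E)` of the vector space `E` with basis `x^1, …, x^q`. -/
abbrev Free : Type u := FreeAlgebra K (Fin q)

/-- The space `E` of generators inside `T(E)`. Its power `E ^ n` (a product of subspaces of `T(E)`)
is the homogeneous component `E^{⊗ n}`, and more generally a product `S * T` of a subspace
`S` of `E^{⊗ m}` and a subspace `T` of `E^{⊗ n}` is `S ⊗ T` inside `E^{⊗ (m+n)}`. -/
def gens : Submodule K (Free K q) :=
  Submodule.span K (Set.range (FreeAlgebra.ι K))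

variable {K q}

/-- The algebra `A(E, R) = T(E) / (R)`, the quotient by the two-sided ideal generated by `R`.
It is `N`-homogeneous when `R ⊆ E^{⊗ N}`. -/
abbrev Alg (R : Submodule K (Free K q)) : Type u :=
  RingQuot fun a b : Free K q => a ∈ R ∧ b = 0

/-- The generator `x^i` of `A(E, R)`. -/
def gen (R : Submodule K (Free K q)) (i : Fin q) : Alg R :=
  RingQuot.mkAlgHom K (fun a b : Free K q => a ∈ R ∧ b = 0) (FreeAlgebra.ι K i)

/-- The homogeneous component of degree `n` of `A(E, R)`. -/
def degreePart (R : Submodule K (Free K q)) (n : ℕ) : Submodule K (Alg R) :=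
  Submodule.span K (Set.range (gen R)) ^ n

/-- `A(E, R)` and `A(E, R')` are isomorphic as graded algebras. -/
def GradedIso (R R' : Submodule K (Free K q)) : Prop :=
  ∃ e : Alg R ≃ₐ[K] Alg R', ∀ n : ℕ,
    (degreePart R n).map (e : Alg R →ₗ[K] Alg R') = degreePart R' n

/-! ### The Koszul complex -/

/-- The linear map `T(E) → T(E)` sending `x^i w` to `w`, and sending `1` and all words
which start with another letter to `0`. -/
def stripLeft (i : Fin q) : Free K q →ₗ[K] Free K q :=
  (FreeAlgebra.basisFreeMonoid K (Fin q)).constr K fun w =>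
    match FreeMonoid.toList w with
    | [] => 0
    | j :: t => if j = i then (t.map (FreeAlgebra.ι K)).prod else 0

/-- The space `J_n ⊆ E^{⊗ n}` (the dual of the degree `n` component of the Koszul dual algebra):
`E^{⊗ n}` for `n < N`, and `⋂_{r + N + s = n} E^{⊗ r} ⊗ R ⊗ E^{⊗ s}` for `n ≥ N`. -/
def koszulDual (N : ℕ) (R : Submodule K (Free K q)) (n : ℕ) : Submodule K (Free K q) :=
  gens K q ^ n ⊓
    ⨅ (r : ℕ) (s : ℕ) (_ : r + N + s = n), gens K q ^ r * R * gens K q ^ s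

/-- The component `A ⊗ J_n` of the Koszul `N`-complex of left `A`-modules, inside `A ⊗ T(E)`. -/
def koszulPart (N : ℕ) (R : Submodule K (Free K q)) (n : ℕ) :
    Submodule (Alg R) (Alg R ⊗[K] Free K q) :=
  (koszulDual N R n).baseChange (Alg R)

/-- The differential of the Koszul `N`-complex,
`d (a ⊗ (v₀ ⊗ v₁ ⊗ ⋯ ⊗ vₙ)) = a v₀ ⊗ (v₁ ⊗ ⋯ ⊗ vₙ)`, as an endomorphism of `A ⊗ T(E)`. -/
def koszulD (R : Submodule K (Free K q)) : Module.End (Alg R) (Alg R ⊗[K] Free K q) :=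
  ∑ i : Fin q, TensorProduct.AlgebraTensorModule.map
    (LinearMap.toSpanSingleton (Alg R) (Alg R) (gen R i)) (stripLeft i)

/-- Exactness at `A ⊗ J_n` of
`A ⊗ J_{n+b} --d^b--> A ⊗ J_n --d^a--> A ⊗ J_{n-a}`, as `ker ⊆ im`. The other inclusion is
automatic when `a + b = N`. -/
def KoszulExactAt (N : ℕ) (R : Submodule K (Free K q)) (n a b : ℕ) : Prop :=
  ∀ z ∈ koszulPart N R n, (koszulD R ^ a) z = 0 →
    ∃ y ∈ koszulPart N R (n + b), (koszulD R ^ b) y = z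

/-- The `N`-homogeneous algebra `A = A(E, R)` is Koszul: its Koszul complex
`⋯ --d^{N-1}--> A ⊗ J_{N+1} --d--> A ⊗ J_N --d^{N-1}--> A ⊗ J_1 --d--> A ⊗ J_0 --> 0`
(the components are those of degrees `kN` and `kN + 1`) is acyclic in positive degrees. -/
def IsKoszul (N : ℕ) (R : Submodule K (Free K q)) : Prop :=
  ∀ k : ℕ, KoszulExactAt N R (k * N + 1) 1 (N - 1) ∧
    KoszulExactAt N R ((k + 1) * N) (N - 1) 1

/-! ### Global dimension and the Gorenstein property -/

open CategoryTheory in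
/-- The (left) global dimension of a ring: the supremum of the projective dimensions of its
left modules. -/
def globalDimension (A : Type u) [Ring A] : WithBot ℕ∞ :=
  ⨆ M : ModuleCat.{u} A, projectiveDimension M

/-- The trivial left module `K = A / A₊`, where the augmentation ideal `A₊` is the left ideal
generated by the generators `x^i`. -/
def trivialModule (R : Submodule K (Free K q)) : ModuleCat.{u} (Alg R) :=
  ModuleCat.of (Alg R) (Alg R ⧸ (Submodule.span (Alg R) (Set.range (gen R))))

open CategoryTheory in
/-- The Gorenstein property in dimension `D`: `Ext^i_A(K, A) = 0` for `i ≠ D`, and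
`Ext^D_A(K, A) ≅ K`, that is, it is one-dimensional over `K`. -/
def IsGorenstein (D : ℕ) (R : Submodule K (Free K q)) : Prop :=
  (∀ i : ℕ, i ≠ D →
    Subsingleton (Abelian.Ext (trivialModule R) (ModuleCat.of (Alg R) (Alg R)) i)) ∧
  Module.finrank K (Abelian.Ext (trivialModule R) (ModuleCat.of (Alg R) (Alg R)) D) = 1

/-! ### Relations attached to a multilinear form -/

/-- The component `W_{i₀ … iₙ} = W(e_{i₀}, …, e_{iₙ})` in the canonical basis of `K^q`. -/
def component {n : ℕ} (W : Form K (Fin q → K) n) (i : Fin (n + 1) → Fin q) : K :=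
  W fun k => Pi.single (i k) 1

/-- The element `∑ W_{l i₁ … i_N} x^{i₁} ⊗ ⋯ ⊗ x^{i_N}` of `E^{⊗ N}`. -/
def relation {N : ℕ} (W : Form K (Fin q → K) N) (l : Fin q) : Free K q :=
  ∑ i : Fin N → Fin q,
    component W (Fin.cons l i) • (List.ofFn fun k => FreeAlgebra.ι K (i k)).prod

/-- The space of relations spanned by `∑ W_{l i₁ … i_N} x^{i₁} ⋯ x^{i_N}`, `l = 1, …, q`. -/
def relations {N : ℕ} (W : Form K (Fin q → K) N) : Submodule K (Free K q) :=
  Submodule.span K (Set.range (relation W))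

end Algebras

end HomogeneousAlgebra

end

-- (a) Koszulity makes `A ⊗ J_{N+1} → A ⊗ R → A ⊗ E → A`, with maps `d`, `d^{N-1}` and
-- multiplication, the start of a free resolution of the trivial module. Global dimension 3 makes
-- the kernel of `d` on `A ⊗ J_{N+1}` a direct summand. Koszulity also puts this kernel inside `A₊ ⊗
-- J_{N+1}`, so a graded Nakayama argument kills it. Applying `Hom(-, A)` then computes the groups
-- `Ext^i(K, A)`, and each Gorenstein condition, read modulo `A₊`, becomes linear algebra on
-- tensors.
--
-- `Ext³` of dimension one forces `J_{N+1} = E ⊗ R ∩ R ⊗ E` to be a line, spanned by the tensor of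
-- some form `W`, and makes `W` nondegenerate in its first slot (`exists_spanning_element`). `Ext² =
-- 0` shows that `R` is spanned by the first-slot slices of that tensor, so `R = R_W`. `Ext¹ = 0`
-- makes `W` nondegenerate in its last slot. Since the tensor also lies in `R ⊗ E`, every last-slot
-- slice is a first-slot slice, which defines the twist `Q` (`isPreregular_of_relations`). A pair
-- `(L₀, L₁)` as in (iii) produces another element of `J_{N+1}`, hence a multiple of `W`, and
-- rigidity follows (`isThreeRegular_of_relations`).
--
-- (b) The linear change of generators dual to `L⁻¹` carries the relations of `W` onto those of its
-- transform (`gradedIso_act`); regularity plays no role.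

universe u v

/-! ### Dimension shifting for Ext -/

section DimensionShifting

open CategoryTheory Abelian

variable {K : Type v} [Field K] {A : Type u} [Ring A] [Algebra K A]
variable {P M : Type u} [AddCommGroup P] [Module A P] [AddCommGroup M] [Module A M]

/-- Precomposition with the class of a short exact sequence, as a linear map between `Ext`s. -/
noncomputable def extClassPrecomp (K : Type v) [Field K] [Algebra K A]
    {S : ShortComplex (ModuleCat.{u} A)} (hS : S.ShortExact)
    (Y : ModuleCat.{u} A) (n : ℕ) : Ext S.X₁ Y n →ₗ[K] Ext S.X₃ Y (n + 1) where
  toFun x := hS.extClass.comp x (add_comm 1 n)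
  map_add' _ _ := Ext.comp_add _ _ _ _
  map_smul' _ _ := Ext.comp_smul _ _ _ _

theorem extClassPrecomp_surjective {S : ShortComplex (ModuleCat.{u} A)} (hS : S.ShortExact)
    [Projective S.X₂] (Y : ModuleCat.{u} A) (n : ℕ) :
    Function.Surjective (extClassPrecomp K hS Y n) := fun x =>
  Ext.contravariant_sequence_exact₃ hS Y x (Ext.eq_zero_of_projective _) (add_comm 1 n)

/-- The shift starts in degree `n + 1` because the obstruction is `Ext^{n+1}(P, Y) = 0`; one degree
lower it would be `Hom(P, Y)`, which need not vanish. -/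
theorem extClassPrecomp_injective {S : ShortComplex (ModuleCat.{u} A)} (hS : S.ShortExact)
    [Projective S.X₂] (Y : ModuleCat.{u} A) (n : ℕ) :
    Function.Injective (extClassPrecomp K hS Y (n + 1)) := by
  rw [← LinearMap.ker_eq_bot, LinearMap.ker_eq_bot']
  intro x hx
  obtain ⟨y, rfl⟩ := Ext.contravariant_sequence_exact₁ hS Y x (add_comm 1 (n + 1)) hx
  rw [Ext.eq_zero_of_projective y, Ext.comp_zero]

variable (K) in
/-- Dimension shifting along a surjection from a projective module. -/
noncomputable def extKerEquiv [Module.Projective A P] (π : P →ₗ[A] M)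
    (hπ : Function.Surjective π) (Y : ModuleCat.{u} A) (n : ℕ) :
    Ext (ModuleCat.of A (LinearMap.ker π)) Y (n + 1) ≃ₗ[K] Ext (ModuleCat.of A M) Y (n + 2) :=
  LinearEquiv.ofBijective
    (extClassPrecomp K (S := π.shortComplexKer) (LinearMap.shortExact_shortComplexKer hπ) Y (n + 1))
    ⟨extClassPrecomp_injective _ Y n, extClassPrecomp_surjective _ Y (n + 1)⟩

theorem projective_ker_of_hasProjectiveDimensionLT [Module.Projective A P] (π : P →ₗ[A] M)
    (hπ : Function.Surjective π) (n : ℕ)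
    (h : HasProjectiveDimensionLT (ModuleCat.of A M) (n + 2)) :
    HasProjectiveDimensionLT (ModuleCat.of A (LinearMap.ker π)) (n + 1) :=
  ((LinearMap.shortExact_shortComplexKer hπ).hasProjectiveDimensionLT_X₃_iff n
    (inferInstanceAs (Projective (ModuleCat.of A P)))).1 h

variable (K) in
/-- The connecting map from homomorphisms on the kernel of `π` to `Ext¹`. -/
noncomputable def homKerToExt (π : P →ₗ[A] M)
    (hπ : Function.Surjective π) (Y : ModuleCat.{u} A) :
    (ModuleCat.of A (LinearMap.ker π) ⟶ Y) →ₗ[K] Ext (ModuleCat.of A M) Y 1 :=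
  extClassPrecomp K (S := π.shortComplexKer) (LinearMap.shortExact_shortComplexKer hπ) Y 0 ∘ₗ
    (Ext.linearEquiv₀ (R := K)).symm.toLinearMap

theorem homKerToExt_surjective [Module.Projective A P] (π : P →ₗ[A] M)
    (hπ : Function.Surjective π) (Y : ModuleCat.{u} A) :
    Function.Surjective (homKerToExt K π hπ Y) :=
  (extClassPrecomp_surjective (K := K) (S := π.shortComplexKer)
    (LinearMap.shortExact_shortComplexKer hπ) Y 0).comp (LinearEquiv.surjective _)

/-- Together with surjectivity for projective `P`, this presents `Ext¹(M, Y)` as the homomorphisms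
on the kernel modulo those that extend to `P`. -/
theorem homKerToExt_eq_zero_iff (π : P →ₗ[A] M)
    (hπ : Function.Surjective π) (Y : ModuleCat.{u} A)
    (f : ModuleCat.of A (LinearMap.ker π) ⟶ Y) :
    homKerToExt K π hπ Y f = 0 ↔ ∃ g : P →ₗ[A] Y, ∀ z, g z.1 = f z := by
  have hS := LinearMap.shortExact_shortComplexKer hπ
  have key : homKerToExt K π hπ Y f = hS.extClass.comp (Ext.mk₀ f) (add_comm 1 0) := rfl
  rw [key]
  constructor
  · intro h
    obtain ⟨y, hy⟩ := Ext.contravariant_sequence_exact₁ hS Y (Ext.mk₀ f) (add_comm 1 0) h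
    obtain ⟨g, rfl⟩ := (Ext.mk₀_bijective _ _).2 y
    rw [Ext.mk₀_comp_mk₀] at hy
    have := (Ext.mk₀_bijective _ _).1 hy
    refine ⟨g.hom, fun z => ?_⟩
    rw [← this]
    rfl
  · rintro ⟨g, hg⟩
    have : f = π.shortComplexKer.f ≫ (ModuleCat.ofHom g : ModuleCat.of A P ⟶ Y) := by
      ext z
      exact (hg z).symm
    rw [this, ← Ext.mk₀_comp_mk₀, hS.extClass_comp_assoc]

theorem exists_extend_sub_smul (π : P →ₗ[A] M)
    (hπ : Function.Surjective π) (Y : ModuleCat.{u} A)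
    {f f₀ : ModuleCat.of A (LinearMap.ker π) ⟶ Y} {c : K}
    (h : homKerToExt K π hπ Y f = c • homKerToExt K π hπ Y f₀) :
    ∃ g : P →ₗ[A] Y, ∀ z, f z = algebraMap K A c • f₀ z + g z.1 := by
  rw [← LinearMap.map_smul, ← sub_eq_zero, ← map_sub] at h
  obtain ⟨g, hg⟩ := (homKerToExt_eq_zero_iff π hπ _ _).1 h
  refine ⟨g, fun z => ?_⟩
  have key : g z.1 = f z - algebraMap K A c • f₀ z := hg z
  rw [key]
  abel

theorem exists_extend_of_subsingleton_ext (K : Type v) [Field K] [Algebra K A] (π : P →ₗ[A] M)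
    (hπ : Function.Surjective π)
    (h : Subsingleton (Ext (ModuleCat.of A M) (ModuleCat.of A A) 1))
    (f : LinearMap.ker π →ₗ[A] A) : ∃ g : P →ₗ[A] A, ∀ z, g z.1 = f z :=
  (homKerToExt_eq_zero_iff (K := K) π hπ (ModuleCat.of A A) (ModuleCat.ofHom f)).1
    (Subsingleton.elim _ _)

theorem exists_generator_of_finrank_ext [Module.Projective A P] (π : P →ₗ[A] M)
    (hπ : Function.Surjective π)
    (h : Module.finrank K (Ext (ModuleCat.of A M) (ModuleCat.of A A) 1) = 1) :
    ∃ f₀ : LinearMap.ker π →ₗ[A] A, f₀ ≠ 0 ∧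
      ∀ f : LinearMap.ker π →ₗ[A] A, ∃ (c : K) (g : P →ₗ[A] A), ∀ z, f z = c • f₀ z + g z.1 := by
  obtain ⟨v, hv, hw⟩ := finrank_eq_one_iff'.1 h
  obtain ⟨f₀, rfl⟩ := homKerToExt_surjective (K := K) π hπ (ModuleCat.of A A) v
  refine ⟨f₀.hom, fun h0 => hv ?_, fun f => ?_⟩
  · have : f₀ = 0 := by ext z; exact LinearMap.congr_fun h0 z
    rw [this, map_zero]
  · obtain ⟨c, hc⟩ := hw (homKerToExt K π hπ (ModuleCat.of A A) (ModuleCat.ofHom f))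
    obtain ⟨g, hg⟩ := exists_extend_sub_smul π hπ (ModuleCat.of A A) hc.symm
    refine ⟨c, g, fun z => ?_⟩
    rw [Algebra.smul_def]
    exact hg z

end DimensionShifting

/-! ### Ext conditions read off a partial resolution -/

section Resolution

open CategoryTheory Abelian

section Definitions

variable {A : Type u} [Semiring A] {T : Type u} [AddCommMonoid T] [Module A T]

/-- `ρ` is a projection of `T` onto the submodule `P`. -/
structure IsProjectionOnto (P : Submodule A T) (ρ : Module.End A T) : Prop where
  mem : ∀ z, ρ z ∈ P
  apply_eq : ∀ z ∈ P, ρ z = z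

/-- The data `P₃ → P₂ → P₁ → A → A ⧸ I → 0` of the beginning of a projective resolution,
realized by endomorphisms of a module `T` of which the `Pᵢ` are direct summands. -/
structure IsPartialResolution (I : Submodule A A) (m : T →ₗ[A] A) (d₂ d₃ : Module.End A T)
    (P₁ P₂ P₃ : Submodule A T) : Prop where
  summand₁ : ∃ ρ, IsProjectionOnto P₁ ρ
  summand₂ : ∃ ρ, IsProjectionOnto P₂ ρ
  summand₃ : ∃ ρ, IsProjectionOnto P₃ ρ
  mem₁ : ∀ z ∈ P₁, m z ∈ I
  surj₁ : ∀ x ∈ I, ∃ z ∈ P₁, m z = x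
  mem₂ : ∀ z ∈ P₂, d₂ z ∈ P₁ ∧ m (d₂ z) = 0
  surj₂ : ∀ y ∈ P₁, m y = 0 → ∃ z ∈ P₂, d₂ z = y
  mem₃ : ∀ z ∈ P₃, d₃ z ∈ P₂ ∧ d₂ (d₃ z) = 0
  surj₃ : ∀ y ∈ P₂, d₂ y = 0 → ∃ z ∈ P₃, d₃ z = y

end Definitions

variable {A : Type u} [Ring A] {T : Type u} [AddCommGroup T] [Module A T]

theorem IsProjectionOnto.projective [Module.Projective A T] {P : Submodule A T}
    {ρ : Module.End A T} (h : IsProjectionOnto P ρ) : Module.Projective A P :=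
  Module.Projective.of_split P.subtype (ρ.codRestrict P h.mem) <| by
    ext z
    exact h.apply_eq z.1 z.2

/-- A homomorphism on a direct summand extends to the whole module. -/
theorem IsProjectionOnto.exists_extend {P : Submodule A T}
    {ρ : Module.End A T} (h : IsProjectionOnto P ρ) {M : Type*} [AddCommGroup M] [Module A M]
    (f : P →ₗ[A] M) : ∃ g : T →ₗ[A] M, ∀ z : P, g z.1 = f z :=
  ⟨f ∘ₗ ρ.codRestrict P h.mem, fun z => congrArg f (Subtype.ext (h.apply_eq z.1 z.2))⟩

namespace IsPartialResolution

variable {I : Submodule A A} {m : T →ₗ[A] A} {d₂ d₃ : Module.End A T} {P₁ P₂ P₃ : Submodule A T}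

theorem exists_factor {M P : Type*} [AddCommGroup M] [Module A M] [AddCommGroup P] [Module A P]
    (π : P →ₗ[A] M) (hπ : Function.Surjective π) (h : P →ₗ[A] A)
    (hh : ∀ z, π z = 0 → h z = 0) : ∃ h' : M →ₗ[A] A, ∀ z, h z = h' (π z) := by
  refine ⟨(LinearMap.ker π).liftQ h hh ∘ₗ (π.quotKerEquivOfSurjective hπ).symm.toLinearMap,
    fun z => ?_⟩
  have : (π.quotKerEquivOfSurjective hπ).symm (π z) = Submodule.Quotient.mk z := by
    rw [LinearEquiv.symm_apply_eq]
    rfl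
  rw [LinearMap.comp_apply, LinearEquiv.coe_coe, this]
  rfl

/-- The four conclusions come from `Ext¹ = 0`, `Ext² = 0`, projective dimension at most 3, and `dim
Ext³ = 1`, by shifting along the syzygies `ker π₀`, `ker π₁`, `ker π₂`. Homomorphisms are taken on
all of `T`: each `Pᵢ` is a summand, so nothing is lost and no subtypes appear later. -/
theorem ext_consequences [Module.Projective A T] (h : IsPartialResolution I m d₂ d₃ P₁ P₂ P₃)
    {K : Type v} [Field K] [Algebra K A]
    (h₁ : Subsingleton (Ext (ModuleCat.of A (A ⧸ I)) (ModuleCat.of A A) 1))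
    (h₂ : Subsingleton (Ext (ModuleCat.of A (A ⧸ I)) (ModuleCat.of A A) 2))
    (h₃ : Module.finrank K (Ext (ModuleCat.of A (A ⧸ I)) (ModuleCat.of A A) 3) = 1)
    (hpd : HasProjectiveDimensionLT (ModuleCat.of A (A ⧸ I)) 4) :
    (∀ f : T →ₗ[A] A, (∀ z ∈ P₂, f (d₂ z) = 0) → ∃ a, ∀ z ∈ P₁, f z = m z * a) ∧
    (∀ f : T →ₗ[A] A, (∀ z ∈ P₃, f (d₃ z) = 0) → ∃ g : T →ₗ[A] A, ∀ z ∈ P₂, f z = g (d₂ z)) ∧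
    (∃ p : Module.End A T, IsProjectionOnto (P₃ ⊓ LinearMap.ker d₃) p) ∧
    (P₃ ⊓ LinearMap.ker d₃ = ⊥ → ∃ f₀ : T →ₗ[A] A, (∃ z ∈ P₃, f₀ z ≠ 0) ∧
      ∀ f : T →ₗ[A] A, ∃ (c : K) (g : T →ₗ[A] A), ∀ z ∈ P₃, f z = c • f₀ z + g (d₃ z)) := by
  obtain ⟨ρ₁, hρ₁⟩ := h.summand₁
  obtain ⟨ρ₂, hρ₂⟩ := h.summand₂
  obtain ⟨ρ₃, hρ₃⟩ := h.summand₃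
  have := hρ₁.projective
  have := hρ₂.projective
  let π₀ : A →ₗ[A] A ⧸ I := I.mkQ
  have hπ₀ : Function.Surjective π₀ := I.mkQ_surjective
  let π₁ : P₁ →ₗ[A] LinearMap.ker π₀ :=
    (m.domRestrict P₁).codRestrict _ fun z => by simpa [π₀] using h.mem₁ z.1 z.2
  have hπ₁ : Function.Surjective π₁ := fun x => by
    obtain ⟨z, hz, hzx⟩ := h.surj₁ x.1 (by simpa [π₀] using x.2)
    exact ⟨⟨z, hz⟩, Subtype.ext hzx⟩
  let π₂ : P₂ →ₗ[A] LinearMap.ker π₁ :=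
    ((d₂.domRestrict P₂).codRestrict P₁ fun z => (h.mem₂ z.1 z.2).1).codRestrict _ fun z =>
      Subtype.ext (h.mem₂ z.1 z.2).2
  have hπ₂ : Function.Surjective π₂ := fun x => by
    obtain ⟨z, hz, hzx⟩ := h.surj₂ x.1 x.1.2 (congrArg Subtype.val x.2)
    exact ⟨⟨z, hz⟩, Subtype.ext (Subtype.ext hzx)⟩
  let π₃ : P₃ →ₗ[A] LinearMap.ker π₂ :=
    ((d₃.domRestrict P₃).codRestrict P₂ fun z => (h.mem₃ z.1 z.2).1).codRestrict _ fun z =>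
      Subtype.ext (Subtype.ext (h.mem₃ z.1 z.2).2)
  have hπ₃ : Function.Surjective π₃ := fun x => by
    obtain ⟨z, hz, hzx⟩ := h.surj₃ x.1 x.1.2 (congrArg (fun y => y.1.1) x.2)
    exact ⟨⟨z, hz⟩, Subtype.ext (Subtype.ext hzx)⟩
  refine ⟨fun f hf => ?_, fun f hf => ?_, ?_, fun hker => ?_⟩
  · obtain ⟨f', hf'⟩ := exists_factor π₁ hπ₁ (f ∘ₗ P₁.subtype) fun z hz => by
      obtain ⟨y, hy, hyz⟩ := h.surj₂ z.1 z.2 (congrArg Subtype.val hz)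
      rw [LinearMap.comp_apply, Submodule.subtype_apply, ← hyz, hf y hy]
    obtain ⟨g, hg⟩ := exists_extend_of_subsingleton_ext K π₀ hπ₀ h₁ f'
    refine ⟨g 1, fun z hz => ?_⟩
    rw [← smul_eq_mul, ← map_smul, smul_eq_mul, mul_one]
    exact (hf' ⟨z, hz⟩).trans (hg (π₁ ⟨z, hz⟩)).symm
  · obtain ⟨f', hf'⟩ := exists_factor π₂ hπ₂ (f ∘ₗ P₂.subtype) fun z hz => by
      obtain ⟨y, hy, hyz⟩ := h.surj₃ z.1 z.2 (congrArg (fun y => y.1.1) hz)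
      rw [LinearMap.comp_apply, Submodule.subtype_apply, ← hyz, hf y hy]
    have e₂ := (extKerEquiv K π₀ hπ₀ (ModuleCat.of A A) 0).toEquiv.subsingleton
    obtain ⟨g, hg⟩ := exists_extend_of_subsingleton_ext K π₁ hπ₁ e₂ f'
    obtain ⟨g', hg'⟩ := hρ₁.exists_extend g
    refine ⟨g', fun z hz => ?_⟩
    exact (hf' ⟨z, hz⟩).trans ((hg (π₂ ⟨z, hz⟩)).symm.trans (hg' (π₂ ⟨z, hz⟩).1).symm)
  · have hp₁ := projective_ker_of_hasProjectiveDimensionLT π₀ hπ₀ 2 hpd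
    have hp₂ := projective_ker_of_hasProjectiveDimensionLT π₁ hπ₁ 1 hp₁
    have hp₃ := projective_ker_of_hasProjectiveDimensionLT π₂ hπ₂ 0 hp₂
    have : Projective (ModuleCat.of A (LinearMap.ker π₂)) :=
      projective_iff_hasProjectiveDimensionLT_one.2 hp₃
    have : Module.Projective A (LinearMap.ker π₂) := (IsProjective.iff_projective _).2 this
    -- The third syzygy is projective, so `π₃` splits, and `1 - s π₃` projects `P₃` onto the kernel
    -- of `d₃`.
    obtain ⟨s, hs⟩ := Module.projective_lifting_property π₃ LinearMap.id hπ₃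
    obtain ⟨p, hp⟩ := hρ₃.exists_extend (P₃.subtype ∘ₗ (LinearMap.id - s ∘ₗ π₃))
    have hs' : ∀ x, d₃ (s x).1 = x.1.1 := fun x => congrArg (fun y => y.1.1) (LinearMap.congr_fun hs x)
    refine ⟨p ∘ₗ ρ₃, fun z => ?_, fun z hz => ?_⟩
    · have := hp ⟨ρ₃ z, hρ₃.mem z⟩
      rw [LinearMap.comp_apply]
      refine ⟨?_, ?_⟩
      · rw [SetLike.mem_coe, this]
        exact ((LinearMap.id - s ∘ₗ π₃ : Module.End A P₃) _).2
      change d₃ (p (ρ₃ z)) = 0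
      rw [this]
      have e := hs' (π₃ ⟨ρ₃ z, hρ₃.mem z⟩)
      simp only [LinearMap.comp_apply, LinearMap.sub_apply, LinearMap.id_apply,
        Submodule.subtype_apply, map_sub, e]
      exact sub_self _
    · rw [LinearMap.comp_apply, hρ₃.apply_eq z hz.1]
      have e : π₃ ⟨z, hz.1⟩ = 0 := Subtype.ext (Subtype.ext hz.2)
      have := hp ⟨z, hz.1⟩
      simpa [e] using this
  · have e₃ : Module.finrank K (Ext (ModuleCat.of A (LinearMap.ker π₁)) (ModuleCat.of A A) 1) = 1 :=
      ((extKerEquiv K π₁ hπ₁ (ModuleCat.of A A) 0).trans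
        (extKerEquiv K π₀ hπ₀ (ModuleCat.of A A) 1)).finrank_eq.trans h₃
    obtain ⟨f₀, hf₀, hf⟩ := exists_generator_of_finrank_ext π₂ hπ₂ e₃
    obtain ⟨F₀, hF₀⟩ := hρ₃.exists_extend (f₀ ∘ₗ π₃)
    refine ⟨F₀, ?_, fun f => ?_⟩
    · by_contra! hc
      refine hf₀ (LinearMap.ext fun x => ?_)
      obtain ⟨z, rfl⟩ := hπ₃ x
      exact (hF₀ z).symm.trans (hc z.1 z.2)
    · obtain ⟨f', hf'⟩ := exists_factor π₃ hπ₃ (f ∘ₗ P₃.subtype) fun z hz => by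
        have : z.1 ∈ P₃ ⊓ LinearMap.ker d₃ := ⟨z.2, congrArg (fun y : LinearMap.ker π₂ => y.1.1) hz⟩
        rw [hker, Submodule.mem_bot] at this
        rw [LinearMap.comp_apply, Submodule.subtype_apply, this, map_zero]
      obtain ⟨c, g, hg⟩ := hf f'
      obtain ⟨G, hG⟩ := hρ₂.exists_extend g
      refine ⟨c, G, fun z hz => ?_⟩
      have h1 := hf' ⟨z, hz⟩
      have h2 := hg (π₃ ⟨z, hz⟩)
      have h3 := hF₀ ⟨z, hz⟩
      have h4 := hG (π₃ ⟨z, hz⟩).1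
      exact h1.trans (h2.trans (congrArg₂ (fun x y => c • x + y) h3.symm h4.symm))

end IsPartialResolution

end Resolution

namespace HomogeneousAlgebra

/-! ### Words in the free algebra -/

section FreeAlgebraLemmas

variable {K : Type u} [Field K] {q : ℕ}

theorem basisFreeMonoid_apply (w : FreeMonoid (Fin q)) :
    FreeAlgebra.basisFreeMonoid K (Fin q) w =
      ((FreeMonoid.toList w).map (FreeAlgebra.ι K)).prod := by
  simp [FreeAlgebra.basisFreeMonoid, FreeAlgebra.equivMonoidAlgebraFreeMonoid, FreeMonoid.lift_apply]

theorem stripLeft_ι_mul (i j : Fin q) (w : Free K q) :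
    stripLeft i (FreeAlgebra.ι K j * w) = if j = i then w else 0 := by
  have : stripLeft i ∘ₗ LinearMap.mulLeft K (FreeAlgebra.ι K j) =
      if j = i then LinearMap.id else (0 : Free K q →ₗ[K] Free K q) := by
    refine (FreeAlgebra.basisFreeMonoid K (Fin q)).ext fun w => ?_
    have h : FreeAlgebra.ι K j * FreeAlgebra.basisFreeMonoid K (Fin q) w =
        FreeAlgebra.basisFreeMonoid K (Fin q) (FreeMonoid.of j * w) := by
      simp [basisFreeMonoid_apply]
    rw [LinearMap.comp_apply, LinearMap.mulLeft_apply, h, stripLeft, Module.Basis.constr_basis]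
    simp only [FreeMonoid.toList_of_mul]
    split_ifs <;> simp [basisFreeMonoid_apply]
  have h := LinearMap.congr_fun this w
  rw [LinearMap.comp_apply, LinearMap.mulLeft_apply] at h
  rw [h]
  split_ifs <;> rfl

theorem ι_mem_gens (i : Fin q) : FreeAlgebra.ι K i ∈ gens K q :=
  Submodule.subset_span ⟨i, rfl⟩

theorem mem_gens_mul {S : Submodule K (Free K q)} {x : Free K q} :
    x ∈ gens K q * S ↔ ∃ s : Fin q → Free K q, (∀ l, s l ∈ S) ∧
      x = ∑ l, FreeAlgebra.ι K l * s l := by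
  constructor
  · intro hx
    induction hx using Submodule.mul_induction_on' with
    | mem_mul_mem m hm n hn =>
      obtain ⟨c, rfl⟩ := (Submodule.mem_span_range_iff_exists_fun K).1 hm
      exact ⟨fun l => c l • n, fun l => S.smul_mem _ hn, by simp [Finset.sum_mul]⟩
    | add x _ y _ hx hy =>
      obtain ⟨s, hs, rfl⟩ := hx
      obtain ⟨t, ht, rfl⟩ := hy
      exact ⟨s + t, fun l => S.add_mem (hs l) (ht l), by simp [mul_add, Finset.sum_add_distrib]⟩
  · rintro ⟨s, hs, rfl⟩
    exact Submodule.sum_mem _ fun l _ => Submodule.mul_mem_mul (ι_mem_gens l) (hs l)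

theorem mem_mul_gens {S : Submodule K (Free K q)} {x : Free K q} :
    x ∈ S * gens K q ↔ ∃ s : Fin q → Free K q, (∀ l, s l ∈ S) ∧
      x = ∑ l, s l * FreeAlgebra.ι K l := by
  constructor
  · intro hx
    induction hx using Submodule.mul_induction_on' with
    | mem_mul_mem n hn m hm =>
      obtain ⟨c, rfl⟩ := (Submodule.mem_span_range_iff_exists_fun K).1 hm
      exact ⟨fun l => c l • n, fun l => S.smul_mem _ hn, by simp [Finset.mul_sum]⟩
    | add x _ y _ hx hy =>
      obtain ⟨s, hs, rfl⟩ := hx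
      obtain ⟨t, ht, rfl⟩ := hy
      exact ⟨s + t, fun l => S.add_mem (hs l) (ht l), by simp [add_mul, Finset.sum_add_distrib]⟩
  · rintro ⟨s, hs, rfl⟩
    exact Submodule.sum_mem _ fun l _ => Submodule.mul_mem_mul (hs l) (ι_mem_gens l)

theorem stripLeft_sum (s : Fin q → Free K q) (i : Fin q) :
    stripLeft i (∑ l, FreeAlgebra.ι K l * s l) = s i := by
  simp [stripLeft_ι_mul]

theorem stripLeft_mem {S : Submodule K (Free K q)} {x : Free K q} (hx : x ∈ gens K q * S)
    (i : Fin q) : stripLeft i x ∈ S := by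
  obtain ⟨s, hs, rfl⟩ := mem_gens_mul.1 hx
  rw [stripLeft_sum]
  exact hs i

end FreeAlgebraLemmas

/-! ### Multilinear forms as homogeneous tensors -/

section Tensor

variable {K : Type u} [Field K] {q n : ℕ}

/-- The element of `E^{⊗ n}` whose coordinates are the components of an `n`-linear form. -/
noncomputable def tensor (K : Type u) [Field K] (q n : ℕ) :
    MultilinearMap K (fun _ : Fin n => Fin q → K) K →ₗ[K] Free K q where
  toFun f := ∑ i : Fin n → Fin q,
    f (fun k => Pi.single (i k) 1) • (List.ofFn fun k => FreeAlgebra.ι K (i k)).prod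
  map_add' f g := by simp [add_smul, Finset.sum_add_distrib]
  map_smul' c f := by simp [Finset.smul_sum, mul_smul]

theorem tensor_apply (f : MultilinearMap K (fun _ : Fin n => Fin q → K) K) :
    tensor K q n f = ∑ i : Fin n → Fin q,
      f (fun k => Pi.single (i k) 1) • (List.ofFn fun k => FreeAlgebra.ι K (i k)).prod := rfl

/-- Insertion of a fixed vector in the last slot of a multilinear form. -/
def lastSlot (f : Form K (Fin q → K) n) (Z : Fin q → K) :
    MultilinearMap K (fun _ : Fin n => Fin q → K) K :=
  (LinearMap.applyₗ Z).compMultilinearMap (MultilinearMap.curryRight f)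

@[simp]
theorem lastSlot_apply (f : Form K (Fin q → K) n) (Z : Fin q → K) (X : Fin n → Fin q → K) :
    lastSlot f Z X = f (Fin.snoc X Z) := rfl

theorem single_comp_cons {l : Fin q} {i : Fin n → Fin q} :
    (fun k => Pi.single ((Fin.cons l i : Fin (n + 1) → Fin q) k) (1 : K) :
      Fin (n + 1) → Fin q → K) =
      Fin.cons (Pi.single l 1) (fun k => Pi.single (i k) 1) := by
  funext k
  refine Fin.cases ?_ (fun j => ?_) k <;> simp

theorem single_comp_snoc {l : Fin q} {i : Fin n → Fin q} :
    (fun k => Pi.single ((Fin.snoc i l : Fin (n + 1) → Fin q) k) (1 : K) :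
      Fin (n + 1) → Fin q → K) =
      Fin.snoc (fun k => Pi.single (i k) 1) (Pi.single l 1) := by
  funext k
  refine Fin.lastCases ?_ (fun j => ?_) k <;> simp

theorem tensor_succ (f : Form K (Fin q → K) n) :
    tensor K q (n + 1) f =
      ∑ l, FreeAlgebra.ι K l * tensor K q n (f.curryLeft (Pi.single l 1)) := by
  simp only [tensor_apply, Finset.mul_sum]
  rw [← Finset.sum_product', Finset.univ_product_univ]
  refine (Fintype.sum_equiv (Fin.consEquiv fun _ => Fin q) _ _ fun p => ?_).symm
  simp [Fin.consEquiv, List.ofFn_succ, single_comp_cons]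

theorem tensor_succ' (f : Form K (Fin q → K) n) :
    tensor K q (n + 1) f =
      ∑ l, tensor K q n (lastSlot f (Pi.single l 1)) * FreeAlgebra.ι K l := by
  simp only [tensor_apply, Finset.sum_mul]
  rw [← Finset.sum_product', Finset.univ_product_univ]
  refine (Fintype.sum_equiv (Fin.snocEquiv fun _ => Fin q) _ _ fun p => ?_).symm
  simp [Fin.snocEquiv, List.ofFn_succ', single_comp_snoc, -List.ofFn_succ]

theorem stripLeft_tensor (f : Form K (Fin q → K) n) (l : Fin q) :
    stripLeft l (tensor K q (n + 1) f) = tensor K q n (f.curryLeft (Pi.single l 1)) := by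
  rw [tensor_succ, stripLeft_sum]

/-- Stripping the first letter `x^l` corresponds to inserting `e_l` in the first slot, so the kernel
vanishes by induction on the degree. -/
theorem tensor_injective (n : ℕ) : Function.Injective (tensor K q n) := by
  rw [← LinearMap.ker_eq_bot, LinearMap.ker_eq_bot']
  induction n with
  | zero =>
    intro f hf
    ext X
    simpa [tensor_apply, Subsingleton.elim X default] using hf
  | succ n ih =>
    intro f hf
    have : f.curryLeft = 0 := by
      refine (Pi.basisFun K (Fin q)).ext fun l => ?_
      refine ih _ ?_
      rw [Pi.basisFun_apply, ← stripLeft_tensor, hf, map_zero]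
    rw [← f.uncurry_curryLeft, this]
    ext X
    simp

theorem tensor_mem (f : MultilinearMap K (fun _ : Fin n => Fin q → K) K) :
    tensor K q n f ∈ gens K q ^ n := by
  induction n with
  | zero =>
    rw [tensor_apply, pow_zero]
    exact Submodule.sum_mem _ fun i _ => Submodule.smul_mem _ _ (by simp)
  | succ n ih =>
    rw [tensor_succ, pow_succ']
    exact mem_gens_mul.2 ⟨_, fun l => ih _, rfl⟩

theorem exists_tensor_eq {x : Free K q} (hx : x ∈ gens K q ^ n) : ∃ f, tensor K q n f = x := by
  induction n generalizing x with
  | zero =>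
    rw [pow_zero, Submodule.mem_one] at hx
    obtain ⟨c, rfl⟩ := hx
    refine ⟨MultilinearMap.constOfIsEmpty K _ c, ?_⟩
    simp [tensor_apply, Algebra.algebraMap_eq_smul_one]
  | succ n ih =>
    rw [pow_succ'] at hx
    obtain ⟨s, hs, rfl⟩ := mem_gens_mul.1 hx
    choose f hf using fun l => ih (hs l)
    refine ⟨LinearMap.uncurryLeft ((Pi.basisFun K (Fin q)).constr K f), ?_⟩
    rw [tensor_succ]
    refine Finset.sum_congr rfl fun l _ => ?_
    rw [LinearMap.curry_uncurryLeft, ← Pi.basisFun_apply, Module.Basis.constr_basis, hf]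

theorem relation_eq (W : Form K (Fin q → K) n) (l : Fin q) :
    relation W l = tensor K q n (W.curryLeft (Pi.single l 1)) := by
  simp only [relation, tensor_apply, component, single_comp_cons, MultilinearMap.curryLeft_apply]

theorem relations_eq_range (W : Form K (Fin q → K) n) :
    relations W = LinearMap.range (tensor K q n ∘ₗ W.curryLeft) := by
  rw [relations, LinearMap.range_eq_map, ← (Pi.basisFun K (Fin q)).span_eq, Submodule.map_span,
    ← Set.range_comp]
  congr 2
  funext l
  simp [relation_eq]

theorem mem_relations {W : Form K (Fin q → K) n} {x : Free K q} :
    x ∈ relations W ↔ ∃ X, tensor K q n (W.curryLeft X) = x := by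
  rw [relations_eq_range]
  rfl

end Tensor

/-! ### Augmentation, linear coefficients and grading of the quotient algebra -/

section Quotient

variable {K : Type u} [Field K] {q : ℕ} (R : Submodule K (Free K q))

/-- The projection of the free algebra onto `A(E, R)`. -/
noncomputable def toAlg : Free K q →ₐ[K] Alg R :=
  RingQuot.mkAlgHom K (fun a b : Free K q => a ∈ R ∧ b = 0)

theorem toAlg_ι (i : Fin q) : toAlg R (FreeAlgebra.ι K i) = gen R i := rfl

variable {R} in
theorem toAlg_eq_zero {r : Free K q} (hr : r ∈ R) : toAlg R r = 0 := by
  rw [toAlg, RingQuot.mkAlgHom_rel K (s := fun a b : Free K q => a ∈ R ∧ b = 0)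
    (show r ∈ R ∧ (0 : Free K q) = 0 from ⟨hr, rfl⟩), map_zero]

section Lift

variable {B : Type*} [Ring B] [Algebra K B]

/-- The universal property of `A(E, R)`. -/
noncomputable def algLift (f : Free K q →ₐ[K] B) (hf : ∀ r ∈ R, f r = 0) : Alg R →ₐ[K] B :=
  RingQuot.liftAlgHom K ⟨f, fun x y h => by rw [h.2, map_zero, hf x h.1]⟩

@[simp]
theorem algLift_toAlg (f : Free K q →ₐ[K] B) (hf : ∀ r ∈ R, f r = 0) (x : Free K q) :
    algLift R f hf (toAlg R x) = f x :=
  RingQuot.liftAlgHom_mkAlgHom_apply K f (fun x y h => by rw [h.2, map_zero, hf x h.1]) x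

@[simp]
theorem algLift_gen (f : Free K q →ₐ[K] B) (hf : ∀ r ∈ R, f r = 0) (i : Fin q) :
    algLift R f hf (gen R i) = f (FreeAlgebra.ι K i) :=
  algLift_toAlg R f hf _

variable {R} in
theorem algHom_ext {f g : Alg R →ₐ[K] B} (h : ∀ i, f (gen R i) = g (gen R i)) : f = g :=
  RingQuot.ringQuot_ext' K f g (FreeAlgebra.hom_ext (funext h))

theorem map_gens (v : Fin q → B) :
    (gens K q).map (FreeAlgebra.lift K v).toLinearMap = Submodule.span K (Set.range v) := by
  rw [gens, Submodule.map_span, ← Set.range_comp]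
  congr 2
  funext i
  simp

theorem lift_eq_zero_of_mem_pow {v : Fin q → B} {N : ℕ} (hv : Submodule.span K (Set.range v) ^ N = ⊥)
    {x : Free K q} (hx : x ∈ gens K q ^ N) : FreeAlgebra.lift K v x = 0 := by
  rw [← Submodule.mem_bot (R := K), ← hv, ← map_gens, ← Submodule.map_pow]
  exact ⟨x, hx, rfl⟩

end Lift

variable {R} {N : ℕ}

/-- The augmentation of `A(E, R)`. -/
noncomputable def augmentation (hR : R ≤ gens K q ^ N) (hN : N ≠ 0) : Alg R →ₐ[K] K :=
  algLift R (FreeAlgebra.lift K 0) fun r hr => lift_eq_zero_of_mem_pow (N := N) (by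
    rw [show Submodule.span K (Set.range (0 : Fin q → K)) = ⊥ from
      Submodule.span_eq_bot.2 (by simp), Submodule.bot_pow hN]) (hR hr)

@[simp]
theorem augmentation_gen (hR : R ≤ gens K q ^ N) (hN : N ≠ 0) (i : Fin q) :
    augmentation hR hN (gen R i) = 0 := by
  simp [augmentation]

theorem augmentation_toAlg (hR : R ≤ gens K q ^ N) (hN : N ≠ 0) {n : ℕ} {x : Free K q}
    (hx : x ∈ gens K q ^ (n + 1)) : augmentation hR hN (toAlg R x) = 0 := by
  rw [pow_succ'] at hx
  obtain ⟨s, -, rfl⟩ := mem_gens_mul.1 hx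
  simp [toAlg_ι]

/-- The homomorphism to the dual numbers which reads off the constant term and the coefficient
of the `i`-th generator. -/
noncomputable def linearCoeff (hR : R ≤ gens K q ^ N) (hN : 2 ≤ N) (i : Fin q) :
    Alg R →ₐ[K] DualNumber K :=
  algLift R (FreeAlgebra.lift K (Pi.single i DualNumber.eps)) fun r hr =>
    lift_eq_zero_of_mem_pow (N := N) (by
      have h : Submodule.span K (Set.range (Pi.single i DualNumber.eps : Fin q → DualNumber K)) =
          Submodule.span K {DualNumber.eps} := by
        refine le_antisymm (Submodule.span_le.2 ?_) (Submodule.span_le.2 ?_)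
        · rintro _ ⟨j, rfl⟩
          by_cases h : j = i
          · subst h
            rw [Pi.single_eq_same]
            exact Submodule.subset_span rfl
          · rw [Pi.single_eq_of_ne h]
            exact Submodule.zero_mem _
        · rintro _ rfl
          exact Submodule.subset_span ⟨i, Pi.single_eq_same _ _⟩
      -- Relations die because `N ≥ 2` and `ε² = 0`.
      rw [h, Submodule.span_pow, Set.singleton_pow, ← Nat.add_sub_cancel' hN, pow_add, sq]
      simp) (hR hr)

theorem linearCoeff_gen (hR : R ≤ gens K q ^ N) (hN : 2 ≤ N) (i j : Fin q) :
    linearCoeff hR hN i (gen R j) = (Pi.single i DualNumber.eps : Fin q → DualNumber K) j := by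
  simp [linearCoeff]

theorem fst_linearCoeff (hR : R ≤ gens K q ^ N) (hN : 2 ≤ N) (i : Fin q) (a : Alg R) :
    (linearCoeff hR hN i a).fst = augmentation hR (by omega) a := by
  have : (TrivSqZeroExt.fstHom K K K).comp (linearCoeff hR hN i) = augmentation hR (by omega) := by
    refine algHom_ext fun j => ?_
    rw [AlgHom.comp_apply, linearCoeff_gen, augmentation_gen]
    by_cases h : j = i
    · subst h; simp
    · simp [h]
  exact DFunLike.congr_fun this a

theorem snd_linearCoeff_sum (hR : R ≤ gens K q ^ N) (hN : 2 ≤ N) (i : Fin q) (a : Fin q → Alg R) :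
    (linearCoeff hR hN i (∑ l, gen R l * a l)).snd = augmentation hR (by omega) (a i) := by
  rw [map_sum, TrivSqZeroExt.snd_sum, Finset.sum_eq_single i]
  · rw [map_mul, linearCoeff_gen, Pi.single_eq_same, TrivSqZeroExt.snd_mul, fst_linearCoeff]
    simp
  · intro j _ hj
    rw [map_mul, linearCoeff_gen, Pi.single_eq_of_ne hj, zero_mul]
    rfl
  · simp

/-- If `x^i = ∑ x^l a_l` in `A(E, R)` then the constant term of `a_l` is `δ_{il}`. -/
theorem augmentation_of_gen_eq_sum (hR : R ≤ gens K q ^ N) (hN : 2 ≤ N) {i : Fin q}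
    {a : Fin q → Alg R} (h : gen R i = ∑ l, gen R l * a l) (j : Fin q) :
    augmentation hR (by omega) (a j) = (Pi.single i 1 : Fin q → K) j := by
  rw [← snd_linearCoeff_sum hR hN, ← h, linearCoeff_gen]
  by_cases hj : j = i
  · subst hj; simp
  · simp [hj, Ne.symm hj]

open Polynomial in
theorem lift_C_mul_X {n : ℕ} {x : Free K q} (hx : x ∈ gens K q ^ n) :
    FreeAlgebra.lift K (fun i => C (gen R i) * X) x = C (toAlg R x) * X ^ n := by
  induction n generalizing x with
  | zero =>
    rw [pow_zero, Submodule.mem_one] at hx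
    obtain ⟨c, rfl⟩ := hx
    simp [Polynomial.algebraMap_apply]
  | succ n ih =>
    rw [pow_succ'] at hx
    obtain ⟨s, hs, rfl⟩ := mem_gens_mul.1 hx
    simp only [map_sum, map_mul, Finset.sum_mul, FreeAlgebra.lift_ι_apply, toAlg_ι]
    refine Finset.sum_congr rfl fun l _ => ?_
    rw [ih (hs l), mul_assoc, ← mul_assoc X, X_mul, mul_assoc, mul_assoc, ← pow_succ']

open Polynomial in
/-- The homomorphism `A → A[X]` which encodes the grading: it sends `a` of degree `n`
to `a X^n`. -/
noncomputable def gradingHom (hR : R ≤ gens K q ^ N) : Alg R →ₐ[K] (Alg R)[X] :=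
  algLift R (FreeAlgebra.lift K fun i => C (gen R i) * X) fun r hr => by
    rw [lift_C_mul_X (hR hr), toAlg_eq_zero hr, map_zero, zero_mul]

open Polynomial in
-- Evaluation at `X = 1`, multiplicative since `1` is central, is a left inverse.
theorem gradingHom_injective (hR : R ≤ gens K q ^ N) : Function.Injective (gradingHom hR) := by
  let ev : (Alg R)[X] →ₐ[K] Alg R :=
    { eval₂RingHom' (RingHom.id (Alg R)) 1 (fun a => Commute.one_right a) with
      commutes' := fun r => by simp [Polynomial.algebraMap_apply] }
  have h : ev.comp (gradingHom hR) = AlgHom.id K _ := by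
    refine algHom_ext fun i => ?_
    have : ∀ p, ev p = eval₂ (RingHom.id (Alg R)) 1 p := fun p => rfl
    rw [AlgHom.comp_apply, gradingHom, algLift_gen, FreeAlgebra.lift_ι_apply, map_mul, this, this]
    simp
  exact Function.LeftInverse.injective (g := ev) fun a => DFunLike.congr_fun h a

/-- The left ideal of elements whose components of degree less than `n` vanish. -/
noncomputable def filtration (hR : R ≤ gens K q ^ N) (n : ℕ) : Submodule (Alg R) (Alg R) where
  carrier := {a | Polynomial.X ^ n ∣ gradingHom hR a}
  add_mem' ha hb := by
    simp only [Set.mem_ofPred_eq, map_add] at *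
    exact dvd_add ha hb
  zero_mem' := by simp
  smul_mem' b a ha := by
    obtain ⟨c, hc⟩ := ha
    refine ⟨gradingHom hR b * c, ?_⟩
    rw [smul_eq_mul, map_mul, hc, ← mul_assoc, ← mul_assoc, Polynomial.X_pow_mul]

theorem gen_mul_mem_filtration (hR : R ≤ gens K q ^ N) {n : ℕ} {a : Alg R}
    (ha : a ∈ filtration hR n) (i : Fin q) : gen R i * a ∈ filtration hR (n + 1) := by
  obtain ⟨c, hc⟩ := ha
  refine ⟨Polynomial.C (gen R i) * c, ?_⟩
  rw [map_mul, hc, gradingHom, algLift_gen, FreeAlgebra.lift_ι_apply, mul_assoc, ← mul_assoc _ _ c,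
    ← pow_succ', Polynomial.X_pow_mul, ← mul_assoc, ← Polynomial.X_pow_mul, ← mul_assoc,
    Polynomial.X_pow_mul, mul_assoc, Polynomial.X_pow_mul]

/-- A polynomial divisible by every power of `X` is zero, so the filtration is separated; this is
what makes Nakayama work without finiteness. -/
theorem eq_zero_of_mem_filtration (hR : R ≤ gens K q ^ N) {a : Alg R}
    (ha : ∀ n, a ∈ filtration hR n) : a = 0 := by
  refine gradingHom_injective hR ?_
  rw [map_zero]
  ext k
  exact Polynomial.X_pow_dvd_iff.1 (ha (k + 1)) k (Nat.lt_succ_self k)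

end Quotient

/-! ### The spaces `J_n` in low degree -/

section KoszulDual

variable {K : Type u} [Field K] {q N : ℕ} {R : Submodule K (Free K q)}

theorem koszulDual_one (hN : 2 ≤ N) : koszulDual N R 1 = gens K q := by
  rw [koszulDual, pow_one, inf_eq_left]
  refine le_iInf fun r => le_iInf fun s => le_iInf fun h => ?_
  omega

theorem koszulDual_self (hR : R ≤ gens K q ^ N) : koszulDual N R N = R := by
  rw [koszulDual]
  refine le_antisymm (inf_le_right.trans ?_) (le_inf hR ?_)
  · refine (iInf_le _ 0).trans ((iInf_le _ 0).trans ((iInf_le _ (by omega)).trans ?_))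
    rw [pow_zero, one_mul, mul_one]
  · refine le_iInf fun r => le_iInf fun s => le_iInf fun h => ?_
    obtain ⟨rfl, rfl⟩ : r = 0 ∧ s = 0 := by omega
    rw [pow_zero, one_mul, mul_one]

theorem koszulDual_succ_self (hR : R ≤ gens K q ^ N) :
    koszulDual N R (N + 1) = gens K q * R ⊓ R * gens K q := by
  rw [koszulDual]
  refine le_antisymm (inf_le_right.trans (le_inf ?_ ?_)) (le_inf ?_ ?_)
  · refine (iInf_le _ 1).trans ((iInf_le _ 0).trans ((iInf_le _ (by omega)).trans ?_))
    rw [pow_zero, pow_one, mul_one]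
  · refine (iInf_le _ 0).trans ((iInf_le _ 1).trans ((iInf_le _ (by omega)).trans ?_))
    rw [pow_zero, pow_one, one_mul]
  · rw [pow_succ']
    exact inf_le_left.trans (mul_le_mul_right hR _)
  · refine le_iInf fun r => le_iInf fun s => le_iInf fun h => ?_
    obtain ⟨rfl, rfl⟩ | ⟨rfl, rfl⟩ : (r = 0 ∧ s = 1) ∨ (r = 1 ∧ s = 0) := by omega
    · rw [pow_zero, pow_one, one_mul]
      exact inf_le_right
    · rw [pow_zero, pow_one, mul_one]
      exact inf_le_left

theorem stripLeft_mem_koszulDual {n : ℕ} {x : Free K q} (hx : x ∈ koszulDual N R (n + 1))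
    (i : Fin q) : stripLeft i x ∈ koszulDual N R n := by
  rw [koszulDual, Submodule.mem_inf] at hx ⊢
  refine ⟨stripLeft_mem (by rw [← pow_succ']; exact hx.1) i, ?_⟩
  simp only [Submodule.mem_iInf] at hx ⊢
  intro r s h
  refine stripLeft_mem ?_ i
  rw [← mul_assoc, ← mul_assoc, ← pow_succ']
  exact hx.2 (r + 1) s (by omega)

end KoszulDual

/-! ### The Koszul complex and graded Nakayama -/

section Complex

variable {K : Type u} [Field K] {q N : ℕ} {R : Submodule K (Free K q)}

/-- The `A`-linear map on `A ⊗ T(E)` which extends a linear map defined on `T(E)`. -/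
noncomputable def extendScalars (h : Free K q →ₗ[K] Alg R) :
    Alg R ⊗[K] Free K q →ₗ[Alg R] Alg R :=
  { TensorProduct.lift ((LinearMap.mul K (Alg R)).compl₂ h) with
    map_smul' := fun a z => by
      induction z with
      | zero => simp
      | add x y hx hy => simpa [mul_add] using congrArg₂ (· + ·) hx hy
      | tmul b w => simp [TensorProduct.smul_tmul', mul_assoc] }

@[simp]
theorem extendScalars_tmul (h : Free K q →ₗ[K] Alg R) (a : Alg R) (w : Free K q) :
    extendScalars h (a ⊗ₜ w) = a * h w := rfl

theorem eq_zero_of_extendScalars {z : Alg R ⊗[K] Free K q}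
    (h : ∀ f : Free K q →ₗ[K] K, extendScalars (Algebra.linearMap K (Alg R) ∘ₗ f) z = 0) :
    z = 0 := by
  let b := FreeAlgebra.basisFreeMonoid K (Fin q)
  refine (Algebra.TensorProduct.basis (Alg R) b).ext_elem fun w => ?_
  have : ∀ z, (Algebra.TensorProduct.basis (Alg R) b).repr z w =
      extendScalars (Algebra.linearMap K (Alg R) ∘ₗ b.coord w) z := by
    intro z
    induction z with
    | zero => simp
    | add x y hx hy => simp [hx, hy]
    | tmul a x =>
      rw [Algebra.TensorProduct.basis_repr_tmul]
      simp
  rw [this, h, map_zero, Finsupp.zero_apply]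

theorem koszulD_tmul (a : Alg R) (w : Free K q) :
    koszulD R (a ⊗ₜ w) = ∑ i, (a * gen R i) ⊗ₜ stripLeft i w := by
  simp [koszulD, LinearMap.sum_apply]

/-- Each application of `d` moves one letter across the tensor sign, so `d^k` moves a whole prefix
of degree `k`. -/
theorem koszulD_pow_tmul {k : ℕ} {x : Free K q} (hx : x ∈ gens K q ^ k) (a : Alg R)
    (w : Free K q) : (koszulD R ^ k) (a ⊗ₜ (x * w)) = (a * toAlg R x) ⊗ₜ w := by
  induction k generalizing x a with
  | zero =>
    rw [pow_zero, Submodule.mem_one] at hx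
    obtain ⟨c, rfl⟩ := hx
    rw [pow_zero, Module.End.one_apply, AlgHom.commutes, ← Algebra.smul_def, ← Algebra.commutes,
      ← Algebra.smul_def, TensorProduct.tmul_smul, TensorProduct.smul_tmul']
  | succ k ih =>
    rw [pow_succ'] at hx
    obtain ⟨s, hs, rfl⟩ := mem_gens_mul.1 hx
    rw [pow_succ, Module.End.mul_apply, koszulD_tmul, map_sum]
    simp only [Finset.sum_mul, mul_assoc, stripLeft_sum fun l => s l * w]
    simp only [map_sum, map_mul, toAlg_ι,
      Finset.mul_sum, TensorProduct.sum_tmul]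
    refine Finset.sum_congr rfl fun l _ => ?_
    rw [ih (hs l), mul_assoc]

theorem koszulD_pow_tensor {n : ℕ} (f : Form K (Fin q → K) n) :
    (koszulD R ^ n) (1 ⊗ₜ tensor K q (n + 1) f) =
      ∑ l, toAlg R (tensor K q n (lastSlot f (Pi.single l 1))) ⊗ₜ FreeAlgebra.ι K l := by
  rw [tensor_succ', TensorProduct.tmul_sum, map_sum]
  refine Finset.sum_congr rfl fun l _ => ?_
  rw [koszulD_pow_tmul (tensor_mem _), one_mul]

theorem koszulPart_eq_span (N : ℕ) (R : Submodule K (Free K q)) (n : ℕ) :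
    koszulPart N R n = Submodule.span (Alg R)
      ((fun w => (1 : Alg R) ⊗ₜ[K] w) '' (koszulDual N R n : Set (Free K q))) := by
  rw [koszulPart, Submodule.baseChange_eq_span]
  rfl

theorem tmul_mem_koszulPart {n : ℕ} {w : Free K q} (hw : w ∈ koszulDual N R n) (a : Alg R) :
    a ⊗ₜ w ∈ koszulPart N R n :=
  Submodule.tmul_mem_baseChange_of_mem a hw

theorem exists_isProjectionOnto_koszulPart (N : ℕ) (R : Submodule K (Free K q)) (n : ℕ) :
    ∃ ρ, IsProjectionOnto (koszulPart N R n) ρ := by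
  obtain ⟨p, hp⟩ := (koszulDual N R n).subtype.exists_leftInverse_of_injective
    (Submodule.ker_subtype _)
  refine ⟨((koszulDual N R n).subtype ∘ₗ p).baseChange (Alg R), fun z => ?_, fun z hz => ?_⟩
  · induction z with
    | zero => rw [map_zero]; exact Submodule.zero_mem _
    | add x y hx hy => rw [map_add]; exact Submodule.add_mem _ hx hy
    | tmul a w =>
      rw [LinearMap.baseChange_tmul]
      exact tmul_mem_koszulPart (p w).2 a
  · rw [koszulPart_eq_span] at hz
    refine LinearMap.eqOn_span (f := ((koszulDual N R n).subtype ∘ₗ p).baseChange (Alg R))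
      (g := LinearMap.id) ?_ hz
    rintro _ ⟨w, hw, rfl⟩
    have : p w = ⟨w, hw⟩ := LinearMap.congr_fun hp ⟨w, hw⟩
    simp [this]

instance : Module.Projective (Alg R) (Alg R ⊗[K] Free K q) :=
  have : Module.Free (Alg R) (Alg R ⊗[K] Free K q) :=
    .of_basis (Algebra.TensorProduct.basis (Alg R) (FreeAlgebra.basisFreeMonoid K (Fin q)))
  inferInstance

/-- The submodule `A₊ ⊗ J_n`. -/
noncomputable def positivePart (N : ℕ) (R : Submodule K (Free K q)) (n : ℕ) :
    Submodule (Alg R) (Alg R ⊗[K] Free K q) :=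
  Submodule.span (Alg R) {x | ∃ l, ∃ w ∈ koszulDual N R n, x = gen R l ⊗ₜ w}

theorem positivePart_le (N : ℕ) (R : Submodule K (Free K q)) (n : ℕ) :
    positivePart N R n ≤ koszulPart N R n := by
  rw [positivePart, Submodule.span_le]
  rintro _ ⟨l, w, hw, rfl⟩
  exact tmul_mem_koszulPart hw _

theorem koszulD_mem_positivePart {n : ℕ} {z : Alg R ⊗[K] Free K q}
    (hz : z ∈ koszulPart N R (n + 1)) : koszulD R z ∈ positivePart N R n := by
  rw [koszulPart_eq_span] at hz
  refine (Submodule.span_le (p := (positivePart N R n).comap (koszulD R))).2 ?_ hz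
  rintro _ ⟨w, hw, rfl⟩
  simp only [SetLike.mem_coe, Submodule.mem_comap, koszulD_tmul, one_mul]
  exact Submodule.sum_mem _ fun i _ =>
    Submodule.subset_span ⟨i, _, stripLeft_mem_koszulDual hw i, rfl⟩

theorem koszulD_mem {n : ℕ} {z : Alg R ⊗[K] Free K q}
    (hz : z ∈ koszulPart N R (n + 1)) : koszulD R z ∈ koszulPart N R n :=
  positivePart_le _ _ _ (koszulD_mem_positivePart hz)

theorem koszulD_pow_mem {n k : ℕ} {z : Alg R ⊗[K] Free K q}
    (hz : z ∈ koszulPart N R (n + k)) : (koszulD R ^ k) z ∈ koszulPart N R n := by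
  induction k generalizing z with
  | zero => exact hz
  | succ k ih =>
    rw [pow_succ, Module.End.mul_apply]
    exact ih (koszulD_mem hz)

theorem map_mem_filtration (hR : R ≤ gens K q ^ N) {n m : ℕ}
    (g : Alg R ⊗[K] Free K q →ₗ[Alg R] Alg R) (hg : ∀ w ∈ koszulDual N R n,
      g (1 ⊗ₜ w) ∈ filtration hR m) {z : Alg R ⊗[K] Free K q} (hz : z ∈ positivePart N R n) :
    g z ∈ filtration hR (m + 1) := by
  refine (Submodule.span_le (p := (filtration hR (m + 1)).comap g)).2 ?_ hz
  rintro _ ⟨l, w, hw, rfl⟩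
  have : gen R l ⊗ₜ[K] w = gen R l • ((1 : Alg R) ⊗ₜ[K] w) := by simp [TensorProduct.smul_tmul']
  rw [SetLike.mem_coe, Submodule.mem_comap, this, map_smul, smul_eq_mul]
  exact gen_mul_mem_filtration hR (hg w hw) l

/-- A graded version of Nakayama's lemma: an idempotent with image in `A₊ ⊗ J_n` vanishes. -/
theorem idempotent_eq_zero (hR : R ≤ gens K q ^ N) {n : ℕ}
    (p : Module.End (Alg R) (Alg R ⊗[K] Free K q)) (hp : ∀ z, p z ∈ positivePart N R n)
    (hpp : ∀ z, p (p z) = p z) (z : Alg R ⊗[K] Free K q) : p z = 0 := by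
  -- Since `p = p ∘ p` and the image of `p` has coefficients in `A₊`, each pass through `p` raises
  -- the filtration order by one.
  have key : ∀ m, ∀ g : Alg R ⊗[K] Free K q →ₗ[Alg R] Alg R, ∀ z, g (p z) ∈ filtration hR m := by
    intro m
    induction m with
    | zero => exact fun g z => ⟨gradingHom hR (g (p z)), by simp⟩
    | succ m ih =>
      intro g z
      rw [← hpp]
      exact map_mem_filtration hR (g ∘ₗ p) (fun w _ => ih g _) (hp z)
  exact eq_zero_of_extendScalars fun f => eq_zero_of_mem_filtration hR fun m => key m _ z

end Complex

/-! ### The Koszul resolution of the trivial module -/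

section Resolution

variable {K : Type u} [Field K] {q N : ℕ} {R : Submodule K (Free K q)}

/-- Identifies the last Koszul map, into `A ⊗ J_0`, with multiplication into `A`, so that exactness
at `J_1` becomes a statement about the augmentation ideal. -/
theorem koszulD_eq_tmul_one (hN : 2 ≤ N) {z : Alg R ⊗[K] Free K q} (hz : z ∈ koszulPart N R 1) :
    koszulD R z = extendScalars (toAlg R).toLinearMap z ⊗ₜ 1 := by
  rw [koszulPart_eq_span, koszulDual_one hN] at hz
  induction hz using Submodule.span_induction with
  | mem x hx =>
    obtain ⟨w, hw, rfl⟩ := hx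
    have := koszulD_pow_tmul (R := R) (k := 1) (by simpa using hw) 1 1
    simpa using this
  | zero => simp
  | add x y _ _ hx hy => simp [hx, hy, TensorProduct.add_tmul]
  | smul a x _ hx => simp [hx, TensorProduct.smul_tmul']

theorem extendScalars_koszulD_pow (hN : 2 ≤ N) (hR : R ≤ gens K q ^ N)
    {z : Alg R ⊗[K] Free K q} (hz : z ∈ koszulPart N R N) :
    extendScalars (toAlg R).toLinearMap ((koszulD R ^ (N - 1)) z) = 0 := by
  obtain ⟨n, rfl⟩ : ∃ n, N = n + 1 := ⟨N - 1, by omega⟩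
  rw [koszulPart_eq_span, koszulDual_self hR] at hz
  refine (Submodule.span_le (p := LinearMap.ker (extendScalars (toAlg R).toLinearMap ∘ₗ
    koszulD R ^ n))).2 ?_ hz
  rintro _ ⟨r, hr, rfl⟩
  obtain ⟨f, rfl⟩ := exists_tensor_eq (hR hr)
  rw [SetLike.mem_coe, LinearMap.mem_ker, LinearMap.comp_apply, koszulD_pow_tensor, map_sum]
  simp only [extendScalars_tmul, AlgHom.toLinearMap_apply, ← map_mul, ← map_sum]
  rw [← tensor_succ', toAlg_eq_zero hr]

theorem koszulD_pow_koszulD (hN : 2 ≤ N) (hR : R ≤ gens K q ^ N)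
    {z : Alg R ⊗[K] Free K q} (hz : z ∈ koszulPart N R (N + 1)) :
    (koszulD R ^ (N - 1)) (koszulD R z) = 0 := by
  rw [← Module.End.mul_apply, ← pow_succ, Nat.sub_add_cancel (by omega)]
  rw [koszulPart_eq_span, koszulDual_succ_self hR] at hz
  refine (Submodule.span_le (p := LinearMap.ker (koszulD R ^ N))).2 ?_ hz
  rintro _ ⟨w, hw, rfl⟩
  obtain ⟨s, hs, rfl⟩ := mem_mul_gens.1 hw.2
  rw [SetLike.mem_coe, LinearMap.mem_ker]
  change (koszulD R ^ N) (1 ⊗ₜ _) = 0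
  rw [TensorProduct.tmul_sum, map_sum]
  refine Finset.sum_eq_zero fun l _ => ?_
  rw [koszulD_pow_tmul (hR (hs l)), toAlg_eq_zero (hs l), mul_zero, TensorProduct.zero_tmul]

theorem IsKoszul.isPartialResolution (hK : IsKoszul N R) (hN : 2 ≤ N) (hR : R ≤ gens K q ^ N) :
    IsPartialResolution (Submodule.span (Alg R) (Set.range (gen R)))
      (extendScalars (toAlg R).toLinearMap) (koszulD R ^ (N - 1)) (koszulD R)
      (koszulPart N R 1) (koszulPart N R N) (koszulPart N R (N + 1)) where
  summand₁ := exists_isProjectionOnto_koszulPart N R 1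
  summand₂ := exists_isProjectionOnto_koszulPart N R N
  summand₃ := exists_isProjectionOnto_koszulPart N R (N + 1)
  mem₁ z hz := by
    rw [koszulPart_eq_span, koszulDual_one hN] at hz
    refine (Submodule.span_le (p := (Submodule.span (Alg R) (Set.range (gen R))).comap
      (extendScalars (toAlg R).toLinearMap))).2 ?_ hz
    rintro _ ⟨w, hw, rfl⟩
    obtain ⟨c, rfl⟩ := (Submodule.mem_span_range_iff_exists_fun K).1 hw
    rw [SetLike.mem_coe, Submodule.mem_comap, extendScalars_tmul, one_mul,
      AlgHom.toLinearMap_apply, map_sum]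
    refine Submodule.sum_mem _ fun l _ => ?_
    rw [map_smul, toAlg_ι, Algebra.smul_def]
    exact Submodule.smul_mem _ _ (Submodule.subset_span ⟨l, rfl⟩)
  surj₁ x hx := by
    refine (Submodule.span_le (p := (koszulPart N R 1).map
      (extendScalars (toAlg R).toLinearMap))).2 ?_ hx
    rintro _ ⟨l, rfl⟩
    refine ⟨1 ⊗ₜ FreeAlgebra.ι K l, tmul_mem_koszulPart ?_ 1, ?_⟩
    · rw [koszulDual_one hN]
      exact ι_mem_gens l
    · simp [toAlg_ι]
  mem₂ z hz := ⟨koszulD_pow_mem (by rwa [Nat.add_sub_cancel' (by omega : 1 ≤ N)]),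
    extendScalars_koszulD_pow hN hR hz⟩
  surj₂ y hy hy0 := by
    have := (hK 0).1 y (by rwa [zero_mul, zero_add])
      (by rw [pow_one, koszulD_eq_tmul_one hN hy, hy0, TensorProduct.zero_tmul])
    rwa [zero_mul, zero_add, Nat.add_sub_cancel' (by omega : 1 ≤ N)] at this
  mem₃ z hz := ⟨koszulD_mem hz, koszulD_pow_koszulD hN hR hz⟩
  surj₃ y hy hy0 := by
    have := (hK 0).2 y (by rwa [zero_add, one_mul]) hy0
    rwa [zero_add, one_mul, pow_one] at this

/-- Exactness at `J_{N+1}` writes a cycle as `d^{N-1} y` with `y` in `A ⊗ J_{2N}`. As `N - 1 ≥ 1`,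
at least one generator has moved to the left factor. -/
theorem IsKoszul.mem_positivePart (hK : IsKoszul N R) (hN : 2 ≤ N)
    {z : Alg R ⊗[K] Free K q} (hz : z ∈ koszulPart N R (N + 1)) (hz0 : koszulD R z = 0) :
    z ∈ positivePart N R (N + 1) := by
  obtain ⟨y, hy, rfl⟩ := (hK 1).1 z (by rwa [one_mul]) (by rwa [pow_one])
  obtain ⟨n, rfl⟩ : ∃ n, N = n + 2 := ⟨N - 2, by omega⟩
  rw [show n + 2 - 1 = n + 1 from rfl, pow_succ', Module.End.mul_apply]
  refine koszulD_mem_positivePart (koszulD_pow_mem ?_)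
  convert hy using 2
  omega

/-- What the Koszul resolution of a Gorenstein algebra of global dimension 3 gives about
homomorphisms to `A`. -/
theorem IsKoszul.exists_of_isGorenstein (hK : IsKoszul N R) (hN : 2 ≤ N) (hR : R ≤ gens K q ^ N)
    (hD : globalDimension (Alg R) = 3) (hG : IsGorenstein 3 R) :
    (∀ f : Alg R ⊗[K] Free K q →ₗ[Alg R] Alg R,
      (∀ z ∈ koszulPart N R N, f ((koszulD R ^ (N - 1)) z) = 0) →
      ∃ a, ∀ z ∈ koszulPart N R 1, f z = extendScalars (toAlg R).toLinearMap z * a) ∧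
    (∀ f : Alg R ⊗[K] Free K q →ₗ[Alg R] Alg R,
      (∀ z ∈ koszulPart N R (N + 1), f (koszulD R z) = 0) →
      ∃ g : Alg R ⊗[K] Free K q →ₗ[Alg R] Alg R,
        ∀ z ∈ koszulPart N R N, f z = g ((koszulD R ^ (N - 1)) z)) ∧
    (∃ f₀ : Alg R ⊗[K] Free K q →ₗ[Alg R] Alg R, (∃ z ∈ koszulPart N R (N + 1), f₀ z ≠ 0) ∧
      ∀ f : Alg R ⊗[K] Free K q →ₗ[Alg R] Alg R, ∃ (c : K)
        (g : Alg R ⊗[K] Free K q →ₗ[Alg R] Alg R),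
        ∀ z ∈ koszulPart N R (N + 1), f z = c • f₀ z + g (koszulD R z)) := by
  have hpd : CategoryTheory.HasProjectiveDimensionLT (trivialModule R) 4 := by
    refine (CategoryTheory.projectiveDimension_le_iff _ 3).1 ?_
    have := le_iSup (fun M : ModuleCat.{u} (Alg R) => CategoryTheory.projectiveDimension M)
      (trivialModule R)
    exact this.trans hD.le
  obtain ⟨h₁, h₂, ⟨p, hp⟩, h₃⟩ := IsPartialResolution.ext_consequences (A := Alg R)
    (T := Alg R ⊗[K] Free K q) (hK.isPartialResolution hN hR)
    (K := K) (hG.1 1 (by norm_num)) (hG.1 2 (by norm_num)) hG.2 hpd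
  refine ⟨h₁, h₂, h₃ ?_⟩
  -- The projection onto the kernel is idempotent with image in `A₊ ⊗ J_{N+1}`, hence zero.
  rw [eq_bot_iff]
  intro z hz
  rw [← hp.apply_eq z hz]
  exact idempotent_eq_zero hR p (fun z => hK.mem_positivePart hN (hp.mem z).1 (hp.mem z).2)
    (fun z => hp.apply_eq _ (hp.mem z)) z

end Resolution

/-! ### Regularity of a form from its space of relations -/

section Regularity

variable {K : Type u} [Field K] {q n : ℕ}

theorem exists_lastSlot_eq (g : Fin q → MultilinearMap K (fun _ : Fin n => Fin q → K) K) :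
    ∃ W : Form K (Fin q → K) n, ∀ l, lastSlot W (Pi.single l 1) = g l := by
  let h : MultilinearMap K (fun _ : Fin n => Fin q → K) ((Fin q → K) →ₗ[K] K) :=
    ∑ l, (LinearMap.toSpanSingleton K ((Fin q → K) →ₗ[K] K) (LinearMap.proj l)).compMultilinearMap
      (g l)
  refine ⟨MultilinearMap.uncurryRight (M := fun _ : Fin (n + 1) => Fin q → K) h, fun l => ?_⟩
  refine MultilinearMap.ext fun X => ?_
  have : lastSlot (MultilinearMap.uncurryRight (M := fun _ : Fin (n + 1) => Fin q → K) h)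
      (Pi.single l 1) X = h X (Pi.single l 1) := by simp
  rw [this]
  simp only [h, sum_apply, LinearMap.sum_apply, LinearMap.compMultilinearMap_apply,
    LinearMap.toSpanSingleton_apply, LinearMap.smul_apply, LinearMap.proj_apply]
  rw [Finset.sum_eq_single l] <;> simp +contextual

/-- The expansion `∑ s_l x^l` is unique: the coefficients `s_l` assemble into a form with the same
tensor, which must be `W`. -/
theorem tensor_lastSlot_mem {S : Submodule K (Free K q)} (hS : S ≤ gens K q ^ n)
    {W : Form K (Fin q → K) n} (hW : tensor K q (n + 1) W ∈ S * gens K q) (l : Fin q) :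
    tensor K q n (lastSlot W (Pi.single l 1)) ∈ S := by
  obtain ⟨s, hs, h⟩ := mem_mul_gens.1 hW
  choose g hg using fun l => exists_tensor_eq (hS (hs l))
  obtain ⟨W', hW'⟩ := exists_lastSlot_eq g
  have : W = W' := by
    refine tensor_injective _ ?_
    rw [h, tensor_succ']
    simp only [hW', hg]
  rw [this, hW', hg]
  exact hs l

theorem isPreregular_of_relations {W : Form K (Fin q → K) n}
    (hnd : ∀ X, W.curryLeft X = 0 → X = 0) (hlast : ∀ Z, lastSlot W Z = 0 → Z = 0)
    (hW : tensor K q (n + 1) W ∈ relations W * gens K q) : IsPreregular W where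
  nondegenerate X hX := hnd X (MultilinearMap.ext hX)
  twisted_cyclic := by
    have hle : relations W ≤ gens K q ^ n := fun x hx => by
      obtain ⟨X, rfl⟩ := mem_relations.1 hx
      exact tensor_mem _
    choose v hv using fun l => mem_relations.1 (tensor_lastSlot_mem hle hW l)
    let Q : Module.End K (Fin q → K) := (Pi.basisFun K (Fin q)).constr K v
    have hQ : ∀ Z, lastSlot W Z = W.curryLeft (Q Z) := by
      intro Z
      refine MultilinearMap.ext fun X => ?_
      let g : (Fin q → K) →ₗ[K] K :=
        { toFun := fun Z => W.curryLeft (Q Z) X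
          map_add' := fun a b => by rw [map_add, map_add, add_apply]
          map_smul' := fun c a => by
            rw [map_smul, map_smul, smul_apply, RingHom.id_apply] }
      have : MultilinearMap.curryRight W X = g := by
        refine (Pi.basisFun K (Fin q)).ext fun l => ?_
        have h1 : Q (Pi.basisFun K (Fin q) l) = v l := Module.Basis.constr_basis _ _ _ _
        change _ = W.curryLeft (Q _) X
        rw [h1, tensor_injective _ (hv l), Pi.basisFun_apply]
        rfl
      exact LinearMap.congr_fun this Z
    have hinj : Function.Injective Q := by
      rw [← LinearMap.ker_eq_bot, LinearMap.ker_eq_bot']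
      intro Z hZ
      refine hlast Z ?_
      rw [hQ, hZ, map_zero]
    exact ⟨LinearEquiv.ofInjectiveEndo Q hinj, fun X Z => DFunLike.congr_fun (hQ Z) X⟩

theorem isThreeRegular_of_relations (hn : 2 ≤ n) {W : Form K (Fin q → K) n}
    (hpre : IsPreregular W)
    (hJ : ∀ x ∈ gens K q * relations W ⊓ relations W * gens K q,
      ∃ c : K, x = c • tensor K q (n + 1) W) : IsThreeRegular W where
  toIsPreregular := hpre
  rigid L₀ L₁ h := by
    obtain ⟨Q, hQ⟩ := hpre.twisted_cyclic
    have hnd := hpre.nondegenerate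
    obtain ⟨m, rfl⟩ : ∃ m, n = m + 1 := ⟨n - 1, by omega⟩
    -- `U(Y, …) = W(L₁ Y, …)` has first-slot slices in `R_W`. By the twist and the hypothesis, `W(L₁
    -- y, Y, Z) = W(Q Z, L₁ y, Y) = W(L₀ Q Z, y, Y)`, so its last-slot slices lie in `R_W` too.
    let U : Form K (Fin q → K) (m + 1) :=
      LinearMap.uncurryLeft (W.curryLeft ∘ₗ L₁ : (Fin q → K) →ₗ[K] _)
    have hU : ∀ Y, U.curryLeft Y = W.curryLeft (L₁ Y) := fun Y => by
      simp only [U, LinearMap.curry_uncurryLeft, LinearMap.comp_apply]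
    have hU' : ∀ Z, lastSlot U Z = W.curryLeft (L₀ (Q Z)) := fun Z => by
      refine MultilinearMap.ext fun X => ?_
      refine Fin.consCases (fun y Y => ?_) X
      have h0 := h (Fin.cons (Q Z) (Fin.cons y Y))
      rw [Fin.update_cons_zero, Fin.cons_zero, ← Fin.succ_zero_eq_one, ← Fin.cons_update,
        Fin.cons_succ, Fin.cons_zero, Fin.update_cons_zero, ← hQ, ← Fin.cons_snoc_eq_snoc_cons] at h0
      rw [lastSlot_apply, MultilinearMap.curryLeft_apply, h0, ← Fin.cons_snoc_eq_snoc_cons,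
        ← MultilinearMap.curryLeft_apply, ← MultilinearMap.curryLeft_apply, hU]
    obtain ⟨c, hc⟩ := hJ (tensor K q _ U) ⟨by
      rw [SetLike.mem_coe, tensor_succ]
      exact mem_gens_mul.2 ⟨_, fun l => mem_relations.2 ⟨_, by rw [hU]⟩, rfl⟩, by
      rw [SetLike.mem_coe, tensor_succ']
      exact mem_mul_gens.2 ⟨_, fun l => mem_relations.2 ⟨_, by rw [hU']⟩, rfl⟩⟩
    rw [← map_smul] at hc
    have hUW := tensor_injective _ hc
    have hL₁ : L₁ = c • LinearMap.id := by
      refine LinearMap.ext fun Y => sub_eq_zero.1 (hnd _ fun X => ?_)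
      have : W.curryLeft (L₁ Y) = c • W.curryLeft Y := by
        rw [← hU, hUW]
        rfl
      rw [← MultilinearMap.curryLeft_apply, map_sub, this, LinearMap.smul_apply, map_smul,
        LinearMap.id_apply, sub_self, zero_apply]
    refine ⟨c, LinearMap.ext fun Y => sub_eq_zero.1 (hnd _ fun X => ?_), hL₁⟩
    have h0 := h (Fin.cons Y X)
    rw [hL₁, LinearMap.smul_apply, LinearMap.id_apply, MultilinearMap.map_update_smul,
      Function.update_eq_self, Fin.update_cons_zero, Fin.cons_zero] at h0
    rw [← MultilinearMap.curryLeft_apply, map_sub, LinearMap.smul_apply, map_smul,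
      LinearMap.id_apply, sub_apply, smul_apply,
      MultilinearMap.curryLeft_apply, MultilinearMap.curryLeft_apply, h0, smul_eq_mul, sub_self]

end Regularity

/-! ### From the Gorenstein property to the form -/

section Gorenstein

theorem map_eq_sum_single {K M : Type*} [Field K] [AddCommGroup M] [Module K M] {q : ℕ}
    (f : (Fin q → K) →ₗ[K] M) (X : Fin q → K) : f X = ∑ j, X j • f (Pi.single j 1) := by
  conv_lhs => rw [← (Pi.basisFun K (Fin q)).sum_repr X]
  simp

theorem lastSlot_eq_sum {K : Type u} [Field K] {q n : ℕ} (f : Form K (Fin q → K) n)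
    (Z : Fin q → K) : lastSlot f Z = ∑ l, Z l • lastSlot f (Pi.single l 1) := by
  refine MultilinearMap.ext fun X => ?_
  change MultilinearMap.curryRight f X Z = _
  rw [map_eq_sum_single (MultilinearMap.curryRight f X) Z, sum_apply]
  rfl

variable {K : Type u} [Field K] {q N : ℕ} {R : Submodule K (Free K q)}

theorem map_koszulD_tmul (g : Alg R ⊗[K] Free K q →ₗ[Alg R] Alg R) (w : Free K q) :
    g (koszulD R (1 ⊗ₜ w)) = ∑ l, gen R l * g (1 ⊗ₜ stripLeft l w) := by
  rw [koszulD_tmul, map_sum]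
  refine Finset.sum_congr rfl fun l _ => ?_
  rw [one_mul, ← smul_eq_mul, ← map_smul, TensorProduct.smul_tmul', smul_eq_mul, mul_one]

theorem augmentation_map_koszulD (hR : R ≤ gens K q ^ N) (hN : N ≠ 0)
    (g : Alg R ⊗[K] Free K q →ₗ[Alg R] Alg R) (w : Free K q) :
    augmentation hR hN (g (koszulD R (1 ⊗ₜ w))) = 0 := by
  simp [map_koszulD_tmul]

theorem exists_spanning_element (hR : R ≤ gens K q ^ N) (hN : N ≠ 0)
    (h₃ : ∃ f₀ : Alg R ⊗[K] Free K q →ₗ[Alg R] Alg R, (∃ z ∈ koszulPart N R (N + 1), f₀ z ≠ 0) ∧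
      ∀ f : Alg R ⊗[K] Free K q →ₗ[Alg R] Alg R, ∃ (c : K)
        (g : Alg R ⊗[K] Free K q →ₗ[Alg R] Alg R),
        ∀ z ∈ koszulPart N R (N + 1), f z = c • f₀ z + g (koszulD R z)) :
    ∃ w ∈ koszulDual N R (N + 1), (∀ x ∈ koszulDual N R (N + 1), ∃ c : K, x = c • w) ∧
      ∀ i, ∃ g : Alg R ⊗[K] Free K q →ₗ[Alg R] Alg R, gen R i = g (koszulD R (1 ⊗ₜ w)) := by
  obtain ⟨f₀, ⟨z, hz, hz0⟩, hf⟩ := h₃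
  let ψ : Free K q →ₗ[K] K := (augmentation hR hN).toLinearMap ∘ₗ (f₀.restrictScalars K) ∘ₗ
    TensorProduct.mk K (Alg R) (Free K q) 1
  have hψ : ∀ x, ψ x = augmentation hR hN (f₀ (1 ⊗ₜ x)) := fun x => rfl
  -- Modulo `A₊` the terms `g ∘ d` disappear, so on `J_{N+1}` every scalar functional is a multiple
  -- of `ψ`; hence `ψ` is injective there.
  have hinj : ∀ x ∈ koszulDual N R (N + 1), ψ x = 0 → x = 0 := by
    intro x hx hx0
    rw [← Module.forall_dual_apply_eq_zero_iff K]
    intro φ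
    obtain ⟨c, g, hg⟩ := hf (extendScalars (Algebra.linearMap K (Alg R) ∘ₗ φ))
    have := congrArg (augmentation hR hN) (hg _ (tmul_mem_koszulPart hx 1))
    rw [map_add, augmentation_map_koszulD, map_smul, ← hψ, hx0] at this
    simpa using this
  obtain ⟨w, hw, hw0⟩ : ∃ w ∈ koszulDual N R (N + 1), w ≠ 0 := by
    by_contra! hc
    refine hz0 ?_
    rw [koszulPart_eq_span] at hz
    refine (Submodule.span_le (p := LinearMap.ker f₀)).2 ?_ hz
    rintro _ ⟨x, hx, rfl⟩
    simp [hc x hx]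
  have hψw : ψ w ≠ 0 := fun h => hw0 (hinj w hw h)
  have hspan : ∀ x ∈ koszulDual N R (N + 1), x = (ψ x / ψ w) • w := fun x hx => by
    refine sub_eq_zero.1 (hinj _ (Submodule.sub_mem _ hx (Submodule.smul_mem _ _ hw)) ?_)
    rw [map_sub, map_smul, smul_eq_mul, div_mul_cancel₀ _ hψw, sub_self]
  refine ⟨w, hw, fun x hx => ⟨_, hspan x hx⟩, fun i => ?_⟩
  -- This homomorphism sends `1 ⊗ w` to `x^i`, which has no constant term. Augmenting forces `c =
  -- 0`, so `x^i` comes from `g ∘ d` alone.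
  obtain ⟨c, g, hg⟩ := hf (extendScalars (LinearMap.toSpanSingleton K (Alg R) (gen R i) ∘ₗ
    ((ψ w)⁻¹ • ψ)))
  have h1 := hg _ (tmul_mem_koszulPart hw 1)
  have h2 : gen R i = c • f₀ (1 ⊗ₜ w) + g (koszulD R (1 ⊗ₜ w)) := by
    rw [← h1]
    simp [hψw]
  have h3 := congrArg (augmentation hR hN) h2
  rw [map_add, augmentation_map_koszulD, map_smul, ← hψ, augmentation_gen, add_zero, smul_eq_mul,
    eq_comm, mul_eq_zero, or_iff_left hψw] at h3
  refine ⟨g, ?_⟩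
  rw [h2, h3, zero_smul, zero_add]

theorem exists_form_of_isGorenstein (hN : 2 ≤ N) (hR : R ≤ gens K q ^ N) (hK : IsKoszul N R)
    (hD : globalDimension (Alg R) = 3) (hG : IsGorenstein 3 R) :
    ∃ W : Form K (Fin q → K) N, IsThreeRegular W ∧ R = relations W := by
  obtain ⟨h₁, h₂, h₃⟩ := hK.exists_of_isGorenstein hN hR hD hG
  have hN0 : N ≠ 0 := by omega
  obtain ⟨w, hw, hspan, hgen⟩ := exists_spanning_element hR hN0 h₃
  have hw' := hw
  rw [koszulDual_succ_self hR] at hw'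
  obtain ⟨W, rfl⟩ := exists_tensor_eq (n := N + 1) (q := q) (K := K) hw.1
  have hle : relations W ≤ R := fun x hx => by
    rw [relations] at hx
    refine (Submodule.span_le.2 ?_) hx
    rintro _ ⟨l, rfl⟩
    rw [relation_eq, ← stripLeft_tensor]
    exact stripLeft_mem hw'.1 l
  have hRW : R = relations W := by
    refine le_antisymm (fun r hr => ?_) hle
    by_contra hrW
    -- A functional vanishing on the slices of `w` is a cocycle on `A ⊗ R`, so by `Ext² = 0` it
    -- factors through `d^{N-1}`. Since `N - 1 ≥ 1`, its value on `r` then lies in `A₊`; being a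
    -- scalar, it is zero.
    obtain ⟨φ, hφr, hφ⟩ := Submodule.exists_le_ker_of_notMem hrW
    obtain ⟨g, hg⟩ := h₂ (extendScalars (Algebra.linearMap K (Alg R) ∘ₗ φ)) fun z hz => by
      rw [koszulPart_eq_span] at hz
      refine (Submodule.span_le (p := LinearMap.ker
        (extendScalars (Algebra.linearMap K (Alg R) ∘ₗ φ) ∘ₗ koszulD R))).2 ?_ hz
      rintro _ ⟨x, hx, rfl⟩
      obtain ⟨c, rfl⟩ := hspan x hx
      rw [SetLike.mem_coe, LinearMap.mem_ker, LinearMap.comp_apply, map_koszulD_tmul]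
      refine Finset.sum_eq_zero fun l _ => ?_
      have : φ (tensor K q N (W.curryLeft (Pi.single l 1))) = 0 := hφ (mem_relations.2 ⟨_, rfl⟩)
      simp [stripLeft_tensor, this]
    have h := hg _ (tmul_mem_koszulPart ((koszulDual_self hR).symm ▸ hr) 1)
    refine hφr ?_
    obtain ⟨n, rfl⟩ : ∃ n, N = n + 2 := ⟨N - 2, by omega⟩
    obtain ⟨f, rfl⟩ := exists_tensor_eq (hR hr)
    have h' := congrArg (augmentation hR hN0) h
    rw [show n + 2 - 1 = n + 1 from rfl, koszulD_pow_tensor, map_sum, map_sum,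
      Finset.sum_eq_zero] at h'
    · simpa using h'
    · intro l _
      have : ∀ (a : Alg R) (x : Free K q), a ⊗ₜ[K] x = a • ((1 : Alg R) ⊗ₜ[K] x) := fun a x => by
        simp [TensorProduct.smul_tmul']
      rw [this, map_smul, smul_eq_mul, map_mul, augmentation_toAlg hR hN0 (tensor_mem _), zero_mul]
  have hnd : ∀ X, W.curryLeft X = 0 → X = 0 := by
    intro X hX
    funext i
    obtain ⟨g, hg⟩ := hgen i
    rw [map_koszulD_tmul] at hg
    have hε := augmentation_of_gen_eq_sum hR hN hg
    -- Comparing linear coefficients in `x^i = ∑ x^l g(1 ⊗ w_l)`, with `w_l` the slices of `w`,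
    -- shows that `χ` is the `i`-th coordinate; yet it depends only on the slice `W(X, …)`.
    let χ : (Fin q → K) →ₗ[K] K := (augmentation hR hN0).toLinearMap ∘ₗ (g.restrictScalars K) ∘ₗ
      TensorProduct.mk K (Alg R) (Free K q) 1 ∘ₗ tensor K q N ∘ₗ W.curryLeft
    have hχ : χ = LinearMap.proj i := by
      refine (Pi.basisFun K (Fin q)).ext fun l => ?_
      have := hε l
      rw [stripLeft_tensor] at this
      rw [Pi.basisFun_apply]
      refine this.trans ?_
      rw [LinearMap.proj_apply, Pi.single_comm]
    have := LinearMap.congr_fun hχ X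
    rw [LinearMap.proj_apply] at this
    rw [← this]
    simp [χ, hX]
  have hlast : ∀ Z, lastSlot W Z = 0 → Z = 0 := by
    intro Z hZ
    -- The functional `x^l ↦ Z_l` extends to a cocycle on `A ⊗ E` exactly because `W(…, Z) = 0`. By
    -- `Ext¹ = 0` it is `x^l ↦ x^l a`, and augmenting gives `Z_l = 0`.
    let φ : Free K q →ₗ[K] K := ∑ l, Z l •
      ((FreeAlgebra.algebraMapInv (R := K) (X := Fin q)).toLinearMap ∘ₗ stripLeft l)
    have hφ : ∀ l, φ (FreeAlgebra.ι K l) = Z l := fun l => by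
      have : ∀ i, stripLeft i (FreeAlgebra.ι K l) = if l = i then (1 : Free K q) else 0 :=
        fun i => by rw [← stripLeft_ι_mul i l 1, mul_one]
      simp [φ, LinearMap.sum_apply, this, apply_ite]
    obtain ⟨a, ha⟩ := h₁ (extendScalars (Algebra.linearMap K (Alg R) ∘ₗ φ)) fun z hz => by
      obtain ⟨n, rfl⟩ : ∃ n, N = n + 1 := ⟨N - 1, by omega⟩
      rw [koszulPart_eq_span, koszulDual_self hR] at hz
      refine (Submodule.span_le (p := LinearMap.ker
        (extendScalars (Algebra.linearMap K (Alg R) ∘ₗ φ) ∘ₗ koszulD R ^ n))).2 ?_ hz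
      rintro _ ⟨x, hx, rfl⟩
      rw [hRW] at hx
      obtain ⟨X, rfl⟩ := mem_relations.1 hx
      rw [SetLike.mem_coe, LinearMap.mem_ker, LinearMap.comp_apply, koszulD_pow_tensor, map_sum]
      have hsum : ∑ l, Z l • lastSlot (W.curryLeft X) (Pi.single l 1) = 0 := by
        rw [← lastSlot_eq_sum]
        refine MultilinearMap.ext fun Y => ?_
        have := DFunLike.congr_fun hZ (Fin.cons X Y)
        rwa [lastSlot_apply, ← Fin.cons_snoc_eq_snoc_cons] at this
      have := congrArg (fun f => toAlg R (tensor K q n f)) hsum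
      simp only [map_sum, map_smul, map_zero] at this
      rw [← this]
      refine Finset.sum_congr rfl fun l _ => ?_
      rw [extendScalars_tmul, LinearMap.comp_apply, hφ, Algebra.linearMap_apply,
        ← Algebra.commutes, Algebra.smul_def]
    funext l
    have h := congrArg (augmentation hR hN0) (ha (1 ⊗ₜ FreeAlgebra.ι K l)
      (tmul_mem_koszulPart (by rw [koszulDual_one hN]; exact ι_mem_gens l) 1))
    simpa [hφ, toAlg_ι] using h
  rw [hRW, koszulDual_succ_self (hRW ▸ hR)] at hspan
  refine ⟨W, isThreeRegular_of_relations hN (isPreregular_of_relations hnd hlast ?_) hspan, hRW⟩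
  rw [← hRW]
  exact hw'.2

end Gorenstein

/-! ### Isomorphisms induced by linear substitutions -/

section Isomorphism

variable {K : Type u} [Field K] {q n : ℕ}

/-- The endomorphism of the free algebra given on generators by the transpose of `M`. -/
noncomputable def substitution (M : Module.End K (Fin q → K)) : Free K q →ₐ[K] Free K q :=
  FreeAlgebra.lift K fun j => ∑ i, M (Pi.single i 1) j • FreeAlgebra.ι K i

theorem substitution_ι (M : Module.End K (Fin q → K)) (j : Fin q) :
    substitution M (FreeAlgebra.ι K j) = ∑ i, M (Pi.single i 1) j • FreeAlgebra.ι K i := by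
  simp [substitution]

theorem curryLeft_eq_sum (f : Form K (Fin q → K) n) (X : Fin q → K) :
    f.curryLeft X = ∑ j, X j • f.curryLeft (Pi.single j 1) :=
  map_eq_sum_single f.curryLeft X

theorem curryLeft_compLinearMap (f : Form K (Fin q → K) n) (M : Module.End K (Fin q → K))
    (X : Fin q → K) : MultilinearMap.curryLeft (f.compLinearMap fun _ => M) X =
      (f.curryLeft (M X)).compLinearMap fun _ => M := by
  refine MultilinearMap.ext fun Y => ?_
  simp only [MultilinearMap.curryLeft_apply, MultilinearMap.compLinearMap_apply]
  congr 1
  funext k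
  refine Fin.cases ?_ (fun j => ?_) k <;> simp

/-- The transpose in `substitution` is chosen so that substituting in a tensor is pulling back its
form along `M`. -/
theorem substitution_tensor (M : Module.End K (Fin q → K))
    (f : MultilinearMap K (fun _ : Fin n => Fin q → K) K) :
    substitution M (tensor K q n f) = tensor K q n (f.compLinearMap fun _ => M) := by
  induction n with
  | zero =>
    simp only [tensor_apply, map_sum, map_smul, List.ofFn_zero, List.prod_nil, map_one]
    refine Finset.sum_congr rfl fun i _ => ?_
    rw [MultilinearMap.compLinearMap_apply]
    congr 2
    exact Subsingleton.elim _ _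
  | succ n ih =>
    rw [tensor_succ, tensor_succ, map_sum]
    simp only [map_mul, ih, substitution_ι, curryLeft_compLinearMap, Finset.sum_mul]
    rw [Finset.sum_comm]
    refine Finset.sum_congr rfl fun i _ => ?_
    rw [← ih, curryLeft_eq_sum]
    simp only [map_sum, map_smul, Finset.mul_sum, ih, smul_mul_assoc, mul_smul_comm]

/-- Substitution is contravariant in `M`, whence the reversed product in the hypothesis. -/
theorem substitution_comp (M M' : Module.End K (Fin q → K)) (h : M' * M = 1) :
    (substitution M).comp (substitution M') = AlgHom.id K (Free K q) := by
  refine FreeAlgebra.hom_ext (funext fun j => ?_)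
  simp only [Function.comp_apply, AlgHom.comp_apply, AlgHom.id_apply, substitution_ι, map_sum,
    map_smul, Finset.smul_sum]
  rw [Finset.sum_comm]
  have key : ∀ l, ∑ i, M' (Pi.single i 1) j • M (Pi.single l 1) i • FreeAlgebra.ι K l =
      (Pi.single l 1 : Fin q → K) j • FreeAlgebra.ι K l := by
    intro l
    have h1 : (M' * M) (Pi.single l 1) j = (Pi.single l 1 : Fin q → K) j := by rw [h]; rfl
    rw [Module.End.mul_apply, map_eq_sum_single M', Finset.sum_apply] at h1
    rw [← h1, Finset.sum_smul]
    exact Finset.sum_congr rfl fun i _ => by rw [smul_smul, mul_comm]; rfl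
  simp only [key]
  rw [Finset.sum_eq_single j] <;> simp +contextual [eq_comm]

theorem substitution_mem_relations {W : Form K (Fin q → K) n} (L : (Fin q → K) ≃ₗ[K] (Fin q → K))
    {x : Free K q} (hx : x ∈ relations W) :
    substitution (L.symm : (Fin q → K) →ₗ[K] (Fin q → K)) x ∈ relations (Form.act L W) := by
  obtain ⟨X, rfl⟩ := mem_relations.1 hx
  -- In the transformed form, `L X` in the first slot cancels `L⁻¹` and leaves `W(X, L⁻¹ ·, …)`.
  refine mem_relations.2 ⟨L X, ?_⟩
  rw [Form.act, curryLeft_compLinearMap, substitution_tensor]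
  simp

theorem act_symm_act (W : Form K (Fin q → K) n) (L : (Fin q → K) ≃ₗ[K] (Fin q → K)) :
    Form.act L.symm (Form.act L W) = W := by
  refine MultilinearMap.ext fun X => ?_
  simp [Form.act]

/-- The homomorphism `A(E, R) → A(E, R')` induced by a substitution which maps `R` to `R'`. -/
noncomputable def algMap {R R' : Submodule K (Free K q)} (M : Module.End K (Fin q → K))
    (h : ∀ r ∈ R, substitution M r ∈ R') : Alg R →ₐ[K] Alg R' :=
  algLift R ((toAlg R').comp (substitution M)) fun r hr => toAlg_eq_zero (h r hr)

theorem algMap_toAlg {R R' : Submodule K (Free K q)} {M : Module.End K (Fin q → K)}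
    (h : ∀ r ∈ R, substitution M r ∈ R') (x : Free K q) :
    algMap M h (toAlg R x) = toAlg R' (substitution M x) :=
  algLift_toAlg R _ _ x

theorem algMap_comp {R R' : Submodule K (Free K q)} {M M' : Module.End K (Fin q → K)}
    (h : ∀ r ∈ R, substitution M r ∈ R') (h' : ∀ r ∈ R', substitution M' r ∈ R)
    (hM : M * M' = 1) : (algMap M' h').comp (algMap M h) = AlgHom.id K _ := by
  refine algHom_ext fun i => ?_
  rw [← toAlg_ι, AlgHom.comp_apply, algMap_toAlg, algMap_toAlg]
  exact congrArg (toAlg R) (DFunLike.congr_fun (substitution_comp M' M hM) (FreeAlgebra.ι K i))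

theorem map_algMap_gens_le {R R' : Submodule K (Free K q)} {M : Module.End K (Fin q → K)}
    (h : ∀ r ∈ R, substitution M r ∈ R') :
    (Submodule.span K (Set.range (gen R))).map (algMap M h).toLinearMap ≤
      Submodule.span K (Set.range (gen R')) := by
  rw [Submodule.map_span_le]
  rintro _ ⟨i, rfl⟩
  rw [AlgHom.toLinearMap_apply, ← toAlg_ι, algMap_toAlg, substitution_ι, map_sum]
  refine Submodule.sum_mem _ fun l _ => ?_
  rw [map_smul, toAlg_ι]
  exact Submodule.smul_mem _ _ (Submodule.subset_span ⟨l, rfl⟩)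

theorem gradedIso_of_substitution {R R' : Submodule K (Free K q)} {M M' : Module.End K (Fin q → K)}
    (h : ∀ r ∈ R, substitution M r ∈ R') (h' : ∀ r ∈ R', substitution M' r ∈ R)
    (hM : M * M' = 1) (hM' : M' * M = 1) : GradedIso R R' := by
  let e : Alg R ≃ₐ[K] Alg R' :=
    AlgEquiv.ofAlgHom (algMap M h) (algMap M' h') (algMap_comp h' h hM') (algMap_comp h h' hM)
  refine ⟨e, fun k => ?_⟩
  have key : (Submodule.span K (Set.range (gen R))).map (algMap M h).toLinearMap =
      Submodule.span K (Set.range (gen R')) := by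
    refine le_antisymm (map_algMap_gens_le h) fun x hx => ?_
    exact ⟨algMap M' h' x, map_algMap_gens_le h' ⟨x, hx, rfl⟩,
      DFunLike.congr_fun (algMap_comp h' h hM') x⟩
  rw [degreePart, degreePart, ← key, ← Submodule.map_pow]
  rfl

theorem gradedIso_act (W : Form K (Fin q → K) n) (L : (Fin q → K) ≃ₗ[K] (Fin q → K)) :
    GradedIso (relations W) (relations (Form.act L W)) := by
  refine gradedIso_of_substitution (M := (L.symm : (Fin q → K) →ₗ[K] (Fin q → K)))
    (M' := (L : (Fin q → K) →ₗ[K] (Fin q → K)))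
    (fun r hr => substitution_mem_relations L hr) (fun r hr => ?_) ?_ ?_
  · have := substitution_mem_relations L.symm hr
    rwa [act_symm_act] at this
  · ext; simp
  · ext; simp

end Isomorphism

end HomogeneousAlgebra

theorem theorem3p3 {K : Type*} [Field K] [IsAlgClosed K] [CharZero K]
    (q N : ℕ) (hq : 2 ≤ q) (hN : 2 ≤ N) :
    (∀ R : Submodule K (HomogeneousAlgebra.Free K q),
      R ≤ HomogeneousAlgebra.gens K q ^ N →
      HomogeneousAlgebra.IsKoszul N R →
      HomogeneousAlgebra.globalDimension (HomogeneousAlgebra.Alg R) = 3 →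
      HomogeneousAlgebra.IsGorenstein 3 R →
      ∃ W : HomogeneousAlgebra.Form K (Fin q → K) N,
        HomogeneousAlgebra.IsThreeRegular W ∧ R = HomogeneousAlgebra.relations W) ∧
    (∀ W W' : HomogeneousAlgebra.Form K (Fin q → K) N,
      HomogeneousAlgebra.IsThreeRegular W → HomogeneousAlgebra.IsThreeRegular W' →
      (∃ L : (Fin q → K) ≃ₗ[K] (Fin q → K), W' = HomogeneousAlgebra.Form.act L W) →
      HomogeneousAlgebra.GradedIso
        (HomogeneousAlgebra.relations W) (HomogeneousAlgebra.relations W')) := by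
  refine ⟨fun R hR hK hD hG => HomogeneousAlgebra.exists_form_of_isGorenstein hN hR hK hD hG, ?_⟩
  rintro W _ - - ⟨L, rfl⟩
  exact HomogeneousAlgebra.gradedIso_act W L
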